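/- **Set-up.** Let $n\ge 1$, let $\Lambda\subseteq\mathbb R^n$ be a lattice of full rank, and let $\Phi$ be an endomorphism of $\mathbb R^n$ with $\Phi(\Lambda)\subseteq\Lambda$ all of whose (complex) eigenvalues have the same absolute value $\rho>1$, where $\rho^n\in\mathbb N$. Let $\|\cdot\|$ be a norm on $\mathbb R^n$ whose induced operator norm satisfies $\|\Phi\|=\rho$ and $\|\Phi^{-1}\|=\rho^{-1}$. Let $\lambda$ be Lebesgue measure. Let $T\subseteq\mathbb R^n$ be closed with $\lambda(\partial T)=0$, $\bigcup_{z\in\Lambda}(z+T)=\mathbb R^n$, and $T\cap(z+T)\subseteq\partial T$ for $0\ne z\in\Lambda$; put $d_\Lambda=\lambda(T)$. Let $r,R>0$ be such that $T$ contains the closed ball of radius $r$ around $0$ and is contained in the closed ball of radius $R$ around $0$, and let $w\ge 1$ be an integer with $R/r<\rho^w-1$. Let $\mathcal D\subseteq\Lambda\cap\Phi^wT$ consist of $0$ and exactly one representative of each residue class of $\Lambda$ modulo $\Phi^w\Lambda$ that is not contained in $\Phi\Lambda$, with $|\mathcal D|=\rho^{n(w-1)}(\rho^n-1)+1$. Let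 $\widetilde T\subseteq T$ be such that $\mathbb R^n$ is the disjoint union of the sets $z+\widetilde T$, $z\in\Lambda$, and for $x=u+v$ with $u\in\Lambda$, $v\in\widetilde T$ put $\{x\}_\Lambda=v$. A *$w$-NAF* is a sequence $\xi\in\mathcal D^{\mathbb Z}$ such that any $w$ consecutive digits contain at most one non-zero digit; its value is $\sum_{j\in\mathbb Z}\Phi^j\xi_j$ (for $\xi$ with $\xi_j=0$ for all large $j$). Let $\mathcal F$ be the set of values of the $w$-NAFs with $\xi_j=0$ for all $j\ge 0$. For $0\ne\eta\in\mathcal D$ let $\mathcal W_\eta$ be the set of values of the $w$-NAFs with $\xi_j=0$ for all $j\ge0$ and $\xi_{-w}=\eta$, and for $j\in\mathbb N_0$ let $\mathcal W_{\eta,j}$ be the set of values of those that in addition satisfy $\xi_i=0$ for all $i<-(j+w)$. For $B\subseteq\mathbb R^n$ and $k\in\mathbb Z$ let $[B]_k=\Phi^{-k}\bigl(\bigcup_{z\in\Phi^kB\cap\Lambda}(z+T)\bigr)$ (cell covering), and put $A_{\eta,j}=[\mathcal W_{\eta,j}]_{j+w}$, $W_{\eta,j}=\{A_{\eta,j}\}_\Lambda$,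 $W_\eta=\{\mathcal W_\eta\}_\Lambda$, $\beta_{\eta,j}=\lambda(A_{\eta,j})-\lambda(\mathcal W_\eta)$, $$E=\frac1{\rho^{n(w-1)}((\rho^n-1)w+1)},\qquad \mu=\Bigl(1+\frac1{\rho^nw^3}\Bigr)^{-1}<1.$$ **Proposition (Properties of the Characteristic Sets).** For every $0\neq\eta\in\mathcal D$ the following hold. (a) $\mathcal W_\eta=\Phi^{-w}\eta+\Phi^{-2w+1}\mathcal F$. (b) $\mathcal W_\eta$ is compact. (c) $\mathcal W_\eta=\overline{\bigcup_{j\in\mathbb N_0}\mathcal W_{\eta,j}}=\overline{\lim_{j\to\infty}\mathcal W_{\eta,j}}$, where the set limit exists (limes inferior and limes superior coincide). (d) $\mathcal W_\eta=\overline{\liminf_{j}A_{\eta,j}}=\overline{\limsup_{j}A_{\eta,j}}$. (e) $\operatorname{int}\mathcal W_\eta\subseteq\liminf_{j}A_{\eta,j}$. (f) $\mathcal W_\eta-\Phi^{-w}\eta\subseteq T$, and $A_{\eta,j}-\Phi^{-w}\eta\subseteq T$ for all $j\in\mathbb N_0$. (g) $W_\eta$ and all $W_{\eta,j}$ are Lebesgue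 measurable, $\lambda(\mathcal W_\eta)=\lambda(W_\eta)$, and $\lambda(A_{\eta,j})=\lambda(W_{\eta,j})$ for all $j\in\mathbb N_0$. (h) $\lambda(A_{\eta,j})=d_\Lambda E+O(\mu^j)$ for $j\in\mathbb N_0$. (i) $\lambda(W_\eta)=d_\Lambda E$. (j) $\beta_{\eta,j}=\int_T(\mathbf 1_{W_{\eta,j}}-\mathbf 1_{W_\eta})(x)\,dx=O(\mu^j)$ for $j\in\mathbb N_0$. The constants in the $O$-terms do not depend on $j$. -/

import Mathlib

open Filter Topology MeasureTheory Set
open scoped ENNReal Pointwise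

noncomputable section

namespace WNAF

variable {E : Type*} [NormedAddCommGroup E] [NormedSpace ℝ E]

/-- `D` is a reduced residue digit set modulo `Φ ^ w`: it consists of `0` and of exactly one
representative of each residue class of `Λ` modulo `Φ ^ w Λ` that is not contained in `Φ Λ`.
(For `w ≥ 1` and `Φ Λ ⊆ Λ`, the class of `z` is contained in `Φ Λ` exactly if `z ∈ Φ Λ`.) -/
structure IsReducedResidueDigitSet (Λ : Submodule ℤ E) (Φ : E ≃L[ℝ] E) (w : ℕ) (D : Set E) :
    Prop where
  subset : D ⊆ Λ
  zero_mem : (0 : E) ∈ D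
  notMem_image : ∀ d ∈ D, d ≠ 0 → d ∉ Φ '' (Λ : Set E)
  existsUnique : ∀ z ∈ Λ, z ∉ Φ '' (Λ : Set E) → ∃! d, d ∈ D ∧ z - d ∈ (Φ ^ w) '' (Λ : Set E)

/-- A bi-infinite sequence of digits is a width-`w` non-adjacent form if each block
`ξ (j + w - 1), …, ξ j` contains at most one non-zero digit. -/
structure IsWNAF (D : Set E) (w : ℕ) (ξ : ℤ → E) : Prop where
  mem : ∀ j, ξ j ∈ D
  block : ∀ j : ℤ, {i | i ∈ Set.Ico j (j + w) ∧ ξ i ≠ 0}.Subsingleton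

/-- The left-length `sup ({0} ∪ {j + 1 | ξ j ≠ 0})`. -/
def leftLength (ξ : ℤ → E) : ℕ∞ := ⨆ j ∈ {j : ℤ | ξ j ≠ 0}, ((j + 1).toNat : ℕ∞)

/-- The right-length `- inf ({0} ∪ {j | ξ j ≠ 0})`. -/
def rightLength (ξ : ℤ → E) : ℕ∞ := ⨆ j ∈ {j : ℤ | ξ j ≠ 0}, ((-j).toNat : ℕ∞)

/-- The set of all width-`w` non-adjacent forms of left-length at most `l` and right-length at
most `r`. -/
def wnafSet (D : Set E) (w : ℕ) (l r : ℕ∞) : Set (ℤ → E) :=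
  {ξ | IsWNAF D w ξ ∧ leftLength ξ ≤ l ∧ rightLength ξ ≤ r}

/-- The value `∑ Φ ^ j (ξ j)`, summed over all integers `j`. -/
def value (Φ : E ≃L[ℝ] E) (ξ : ℤ → E) : E := ∑' j : ℤ, (Φ ^ j) (ξ j)

/-- The fundamental domain: all values of non-adjacent forms of left-length `0`. -/
def fundDomain (Φ : E ≃L[ℝ] E) (D : Set E) (w : ℕ) : Set E := value Φ '' wnafSet D w 0 ⊤

/-- The tiling property of `T` with respect to the lattice `Λ`, for closed `T` with boundary of
measure zero. -/
structure IsTiling [MeasurableSpace E] (vol : Measure E) (Λ : Submodule ℤ E) (T : Set E) :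
    Prop where
  iUnion_eq : ⋃ z ∈ Λ, (z +ᵥ T) = univ
  inter_subset : ∀ z ∈ Λ, z ≠ 0 → T ∩ (z +ᵥ T) ⊆ frontier T
  isClosed : IsClosed T
  frontier_null : vol (frontier T) = 0

/-- The space is the disjoint union of the translates `z + T'`, `z ∈ Λ`, that is, each point has
exactly one decomposition `x = u + v` with `u ∈ Λ` and `v ∈ T'`. -/
def IsExactTiling (Λ : Submodule ℤ E) (T' : Set E) : Prop :=
  ∀ x : E, ∃! v : E, v ∈ T' ∧ x - v ∈ Λ

/-- The fractional part: the `v` in `x = u + v` with `u ∈ Λ` and `v ∈ T'`. -/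
def fracPart {Λ : Submodule ℤ E} {T' : Set E} (h : IsExactTiling Λ T') (x : E) : E :=
  (h x).choose

/-- The cell covering of the lattice points inside `B`. -/
def cellCover (Λ : Submodule ℤ E) (T B : Set E) : Set E := ⋃ z ∈ B ∩ (Λ : Set E), (z +ᵥ T)

/-- The scaled cell covering `Φ ^ (-j) (cellCover (Φ ^ j B))`. -/
def cellCoverAt (Λ : Submodule ℤ E) (T : Set E) (Φ : E ≃L[ℝ] E) (j : ℤ) (B : Set E) : Set E :=
  (Φ ^ (-j)) '' cellCover Λ T ((Φ ^ j) '' B)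

/-- The characteristic set of the digit `η`. -/
def charSet (Φ : E ≃L[ℝ] E) (D : Set E) (w : ℕ) (η : E) : Set E :=
  value Φ '' {ξ | ξ ∈ wnafSet D w 0 ⊤ ∧ ξ (-(w : ℤ)) = η}

/-- The finite-level set of the digit `η`. -/
def charSetLevel (Φ : E ≃L[ℝ] E) (D : Set E) (w : ℕ) (η : E) (j : ℕ) : Set E :=
  value Φ '' {ξ | ξ ∈ wnafSet D w 0 ((j + w : ℕ) : ℕ∞) ∧ ξ (-(w : ℤ)) = η}

/-- The `j`th approximation of the characteristic set of the digit `η`. -/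
def charApprox (Λ : Submodule ℤ E) (T : Set E) (Φ : E ≃L[ℝ] E) (D : Set E) (w : ℕ) (η : E)
    (j : ℕ) : Set E :=
  cellCoverAt Λ T Φ ((j : ℤ) + w) (charSetLevel Φ D w η j)

/-- The difference between the measures of the `j`th approximation and of the characteristic
set. -/
def beta [MeasurableSpace E] (vol : Measure E) (Λ : Submodule ℤ E) (T : Set E) (Φ : E ≃L[ℝ] E)
    (D : Set E) (w : ℕ) (η : E) (j : ℕ) : ℝ :=
  vol.real (charApprox Λ T Φ D w η j) - vol.real (charSet Φ D w η)

/-- The constant `1 / (ρ ^ (n (w - 1)) ((ρ ^ n - 1) w + 1))`. -/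
def expectConst (ρ : ℝ) (n w : ℕ) : ℝ := 1 / (ρ ^ (n * (w - 1)) * ((ρ ^ n - 1) * w + 1))

/-- The constant `(1 + 1 / (ρ ^ n w ^ 3))⁻¹`. -/
def decayConst (ρ : ℝ) (n w : ℕ) : ℝ := (1 + 1 / (ρ ^ n * (w : ℝ) ^ 3))⁻¹

end WNAF

end

/-!
A non-zero non-adjacent form is located by its leading digit: since `R / r < ρ ^ w - 1`, the digits
below it move the value by too little to leave the tile. So the lattice points among the values of
forms supported below `m` are exactly the values of the `m`-digit integers, each with a unique
expansion. Thus a lattice point of `Φ ^ (j + w) (charSet η)` is already one of level `j`, which puts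
the interior of `charSet η` into the limes inferior of the approximations, while their limes
superior stays inside `charSet η`.

With `q = ρ ^ n`, the number `N m` of `m`-digit integers satisfies
`N (m + 1) = N m + q ^ (w - 1) (q - 1) N (m + 1 - w)`. The dominant characteristic root is `q`, and
after normalisation by `q` all the others have modulus below `(1 + 1 / (q w ^ 3))⁻¹`; this gives the
volumes of the approximations with exponential error.

These volumes converge to that of `charSet η` because its boundary is a null set. Division with
remainder shows that the lattice translates of the fundamental domain `F` cover the space, so `F`
has interior points by Baire's theorem. Sorting by the digit at position `-1` exhibits `F` as a
union of similar copies with volume ratios adding up to `1`. Hence the boundary of each copy lies in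
`∂F` up to a null set; as a small iterated copy fits into the interior of `F`, `∂F` is null.
-/

namespace WNAF

/-! ### Integer powers of a similarity -/

section Powers

variable {E : Type*} [NormedAddCommGroup E] [NormedSpace ℝ E]

lemma zpow_add_apply (Φ : E ≃L[ℝ] E) (a b : ℤ) (x : E) :
    (Φ ^ (a + b)) x = (Φ ^ a) ((Φ ^ b) x) := by
  rw [zpow_add]; rfl

lemma zpow_neg_zpow_apply (Φ : E ≃L[ℝ] E) (a : ℤ) (x : E) : (Φ ^ (-a)) ((Φ ^ a) x) = x := by
  rw [← zpow_add_apply, neg_add_cancel]; rfl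

lemma zpow_zpow_neg_apply (Φ : E ≃L[ℝ] E) (a : ℤ) (x : E) : (Φ ^ a) ((Φ ^ (-a)) x) = x := by
  rw [← zpow_add_apply, add_neg_cancel]; rfl

lemma zpow_one_apply (Φ : E ≃L[ℝ] E) (x : E) : (Φ ^ (1 : ℤ)) x = Φ x := by
  rw [zpow_one]

lemma image_zpow_image (Φ : E ≃L[ℝ] E) (a b : ℤ) (s : Set E) :
    (Φ ^ a) '' ((Φ ^ b) '' s) = (Φ ^ (a + b)) '' s := by
  rw [image_image]
  exact image_congr fun x _ => (zpow_add_apply Φ a b x).symm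

lemma image_zpow_zero (Φ : E ≃L[ℝ] E) (s : Set E) : (Φ ^ (0 : ℤ)) '' s = s :=
  image_id s

lemma norm_map_of_norm_eq_of_norm_symm_eq {Φ : E ≃L[ℝ] E} {ρ : ℝ} (hρ : 0 < ρ)
    (hnorm : ‖(Φ : E →L[ℝ] E)‖ = ρ) (hinv : ‖(Φ.symm : E →L[ℝ] E)‖ = ρ⁻¹) (x : E) :
    ‖Φ x‖ = ρ * ‖x‖ := by
  refine le_antisymm (hnorm ▸ (Φ : E →L[ℝ] E).le_opNorm x) ?_
  have hsymm : ‖x‖ ≤ ρ⁻¹ * ‖Φ x‖ := by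
    simpa [hinv] using (Φ.symm : E →L[ℝ] E).le_opNorm (Φ x)
  rwa [inv_mul_eq_div, le_div_iff₀' hρ] at hsymm

lemma norm_zpow_apply {Φ : E ≃L[ℝ] E} {ρ : ℝ} (hρ : ρ ≠ 0) (hΦ : ∀ x, ‖Φ x‖ = ρ * ‖x‖) (k : ℤ)
    (x : E) : ‖(Φ ^ k) x‖ = ρ ^ k * ‖x‖ := by
  induction k generalizing x with
  | zero => rw [zpow_zero, zpow_zero, one_mul]; rfl
  | succ i ih =>
    rw [zpow_add_apply, ih, zpow_one_apply, hΦ, zpow_add₀ hρ, zpow_one, mul_assoc]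
  | pred i ih =>
    have hstep : ‖(Φ ^ (-(i : ℤ))) x‖ = ρ * ‖(Φ ^ (-(i : ℤ) - 1)) x‖ := by
      rw [← hΦ, ← zpow_one_apply Φ, ← zpow_add_apply, add_sub_cancel]
    rw [zpow_sub_one₀ hρ, mul_right_comm, ← ih, hstep, mul_right_comm, mul_inv_cancel₀ hρ, one_mul]

end Powers

/-! ### Non-adjacent forms supported in a set of positions -/

section Expansions

variable {E : Type*} [NormedAddCommGroup E] {D : Set E} {w : ℕ} {I J : Set ℤ} {ξ : ℤ → E}

lemma isWNAF_iff_forall_lt :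
    IsWNAF D w ξ ↔ (∀ j, ξ j ∈ D) ∧ ∀ i k : ℤ, i < k → k < i + w → ξ i = 0 ∨ ξ k = 0 := by
  constructor
  · rintro ⟨hmem, hblock⟩
    refine ⟨hmem, fun i k hik hki => ?_⟩
    by_contra! hne
    exact hik.ne (hblock i ⟨⟨le_rfl, by lia⟩, hne.1⟩ ⟨⟨hik.le, hki⟩, hne.2⟩)
  · rintro ⟨hmem, hzero⟩
    refine ⟨hmem, fun j i ⟨⟨hji, hij⟩, hi⟩ k ⟨⟨hjk, hkj⟩, hk⟩ => ?_⟩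
    rcases lt_trichotomy i k with h | h | h
    · exact ((hzero i k h (by lia)).elim hi hk).elim
    · exact h
    · exact ((hzero k i h (by lia)).elim hk hi).elim

lemma IsWNAF.eq_zero_or_eq_zero (hξ : IsWNAF D w ξ) {i k : ℤ} (hik : i < k) (hki : k < i + w) :
    ξ i = 0 ∨ ξ k = 0 :=
  (isWNAF_iff_forall_lt.1 hξ).2 i k hik hki

/-- The width-`w` non-adjacent forms supported in `I`. Intervals `I` describe the forms of bounded
left- and right-length, and removing positions from `I` isolates single digits. -/
def expansionSet (D : Set E) (w : ℕ) (I : Set ℤ) : Set (ℤ → E) :=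
  {ξ | IsWNAF D w ξ ∧ ∀ i, ξ i ≠ 0 → i ∈ I}

lemma expansionSet_mono (h : I ⊆ J) : expansionSet D w I ⊆ expansionSet D w J :=
  fun _ hξ => ⟨hξ.1, fun i hi => h (hξ.2 i hi)⟩

lemma eq_zero_of_mem_expansionSet (hξ : ξ ∈ expansionSet D w I) {i : ℤ} (hi : i ∉ I) : ξ i = 0 :=
  not_imp_comm.1 (hξ.2 i) hi

lemma zero_mem_expansionSet (h0 : (0 : E) ∈ D) (I : Set ℤ) : (0 : ℤ → E) ∈ expansionSet D w I :=
  ⟨isWNAF_iff_forall_lt.2 ⟨fun _ => h0, fun _ _ _ _ => Or.inl rfl⟩, fun _ h => absurd rfl h⟩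

lemma shift_mem_expansionSet {k : ℤ} (hIJ : ∀ i, i ∈ I ↔ i + k ∈ J)
    (hξ : ξ ∈ expansionSet D w I) : (fun j => ξ (j - k)) ∈ expansionSet D w J := by
  refine ⟨isWNAF_iff_forall_lt.2 ⟨fun j => hξ.1.mem _, fun i j hij hji => ?_⟩, fun i hi => ?_⟩
  · exact hξ.1.eq_zero_or_eq_zero (by lia) (by lia)
  · simpa using (hIJ _).1 (hξ.2 _ hi)

lemma update_zero_mem_expansionSet (h0 : (0 : E) ∈ D) (hξ : ξ ∈ expansionSet D w I) {i : ℤ}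
    (hi : ξ i ≠ 0) :
    Function.update ξ i 0 ∈ expansionSet D w (I \ Ioo (i - w) (i + w)) := by
  refine ⟨isWNAF_iff_forall_lt.2 ⟨fun j => ?_, fun j k hjk hkj => ?_⟩, fun j hj => ?_⟩
  · rcases eq_or_ne j i with rfl | h
    · simpa using h0
    · simpa [h] using hξ.1.mem j
  · have := hξ.1.eq_zero_or_eq_zero hjk hkj
    grind [Function.update_apply]
  · have hji : j ≠ i := by rintro rfl; simp at hj
    rw [Function.update_of_ne hji] at hj
    refine ⟨hξ.2 j hj, fun ⟨hlt, hgt⟩ => ?_⟩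
    rcases lt_or_gt_of_ne hji with h | h
    · exact (hξ.1.eq_zero_or_eq_zero h (by lia)).elim hj hi
    · exact (hξ.1.eq_zero_or_eq_zero h hgt).elim hi hj

lemma update_mem_expansionSet {i : ℤ} (hi : i ∈ I) {η : E} (hη : η ∈ D)
    (hξ : ξ ∈ expansionSet D w (I \ Ioo (i - w) (i + w))) :
    Function.update ξ i η ∈ expansionSet D w I := by
  have hzero (j : ℤ) (hlt : i - w < j) (hgt : j < i + w) : ξ j = 0 :=
    eq_zero_of_mem_expansionSet hξ fun h => h.2 ⟨hlt, hgt⟩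
  refine ⟨isWNAF_iff_forall_lt.2 ⟨fun j => ?_, fun j k hjk hkj => ?_⟩, fun j hj => ?_⟩
  · rcases eq_or_ne j i with rfl | h
    · simpa using hη
    · simpa [h] using hξ.1.mem j
  · have := hξ.1.eq_zero_or_eq_zero hjk hkj
    grind [Function.update_apply]
  · rcases eq_or_ne j i with rfl | h
    · exact hi
    · exact (hξ.2 j (by simpa [h] using hj)).1

lemma truncate_mem_expansionSet (h0 : (0 : E) ∈ D) (hξ : ξ ∈ expansionSet D w I) (s : Finset ℤ) :
    (fun i => if i ∈ s then ξ i else 0) ∈ expansionSet D w (I ∩ s) := by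
  refine ⟨isWNAF_iff_forall_lt.2 ⟨fun j => ?_, fun j k hjk hkj => ?_⟩, fun j hj => ?_⟩
  · split_ifs
    exacts [hξ.1.mem j, h0]
  · have := hξ.1.eq_zero_or_eq_zero hjk hkj
    grind
  · simp only [ne_eq, ite_eq_right_iff, not_forall] at hj
    exact ⟨hξ.2 j hj.2, hj.1⟩

lemma leftLength_le_zero_iff : leftLength ξ ≤ 0 ↔ ∀ i, ξ i ≠ 0 → i ∈ Iio (0 : ℤ) := by
  simp only [leftLength, iSup_le_iff, mem_ofPred_eq, mem_Iio]
  refine forall₂_congr fun i _ => ?_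
  rw [← Nat.cast_zero, Nat.cast_le]
  lia

lemma rightLength_le_natCast_iff (m : ℕ) :
    rightLength ξ ≤ m ↔ ∀ i, ξ i ≠ 0 → i ∈ Ici (-(m : ℤ)) := by
  simp only [rightLength, iSup_le_iff, mem_ofPred_eq, mem_Ici]
  refine forall₂_congr fun i _ => ?_
  rw [Nat.cast_le]
  lia

lemma wnafSet_zero_top : wnafSet D w 0 ⊤ = expansionSet D w (Iio 0) := by
  ext ξ
  simp only [wnafSet, expansionSet, mem_ofPred_eq, le_top, and_true, leftLength_le_zero_iff]

lemma wnafSet_zero_natCast (m : ℕ) :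
    wnafSet D w 0 (m : ℕ∞) = expansionSet D w (Ico (-(m : ℤ)) 0) := by
  ext ξ
  simp only [wnafSet, expansionSet, mem_ofPred_eq, leftLength_le_zero_iff,
    rightLength_le_natCast_iff, ← forall_and, ← Ici_inter_Iio, mem_inter_iff]
  exact and_congr_right fun _ => forall_congr' fun i => by tauto

lemma isCompact_expansionSet (hD : D.Finite) (I : Set ℤ) : IsCompact (expansionSet D w I) := by
  have hpi : expansionSet D w I = univ.pi (fun _ => D) ∩
      ((⋂ (i : ℤ) (k : ℤ) (_ : i < k) (_ : k < i + w), {ξ : ℤ → E | ξ i = 0 ∨ ξ k = 0}) ∩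
        ⋂ (i : ℤ) (_ : i ∉ I), {ξ : ℤ → E | ξ i = 0}) := by
    ext ξ
    simp only [expansionSet, isWNAF_iff_forall_lt, mem_ofPred_eq, mem_inter_iff, mem_univ_pi,
      mem_iInter, and_assoc, ne_eq, not_imp_comm]
  have hclosed (i : ℤ) : IsClosed {ξ : ℤ → E | ξ i = 0} :=
    isClosed_eq (continuous_apply i) continuous_const
  rw [hpi]
  refine (isCompact_univ_pi fun _ => hD.isCompact).inter_right (IsClosed.inter ?_ ?_)
  · exact isClosed_iInter fun i => isClosed_iInter fun k => isClosed_iInter fun _ =>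
      isClosed_iInter fun _ => (hclosed i).union (hclosed k)
  · exact isClosed_iInter fun i => isClosed_iInter fun _ => hclosed i

end Expansions

/-! ### Values of non-adjacent forms -/

section Values

variable {E : Type*} [NormedAddCommGroup E] [NormedSpace ℝ E] {Φ : E ≃L[ℝ] E} {ρ : ℝ} {D : Set E}
  {w : ℕ} {I J : Set ℤ} {ξ : ℤ → E}

/-- The values of the width-`w` non-adjacent forms supported in `I`. The fundamental domain, the
characteristic sets and their finite levels are all described by sets of this form. -/
def valueSet (Φ : E ≃L[ℝ] E) (D : Set E) (w : ℕ) (I : Set ℤ) : Set E :=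
  value Φ '' expansionSet D w I

lemma fundDomain_eq_valueSet : fundDomain Φ D w = valueSet Φ D w (Iio 0) := by
  rw [fundDomain, wnafSet_zero_top, valueSet]

lemma valueSet_mono (h : I ⊆ J) : valueSet Φ D w I ⊆ valueSet Φ D w J :=
  image_mono (expansionSet_mono h)

lemma value_zero : value Φ (0 : ℤ → E) = 0 := by
  simp [value]

lemma zero_mem_valueSet (h0 : (0 : E) ∈ D) (I : Set ℤ) : (0 : E) ∈ valueSet Φ D w I :=
  ⟨0, zero_mem_expansionSet h0 I, value_zero⟩

lemma valueSet_empty (h0 : (0 : E) ∈ D) : valueSet Φ D w ∅ = {0} := by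
  refine Subset.antisymm ?_ (singleton_subset_iff.2 (zero_mem_valueSet h0 _))
  rintro _ ⟨ξ, hξ, rfl⟩
  obtain rfl : ξ = 0 := funext fun i => eq_zero_of_mem_expansionSet hξ (notMem_empty i)
  exact value_zero

lemma value_shift (Φ : E ≃L[ℝ] E) (k : ℤ) (ξ : ℤ → E) :
    value Φ (fun j => ξ (j - k)) = (Φ ^ k) (value Φ ξ) := by
  rw [value, value, ContinuousLinearEquiv.map_tsum, ← (Equiv.addRight k).tsum_eq]
  refine tsum_congr fun j => ?_
  simp only [Equiv.coe_addRight, add_sub_cancel_right]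
  rw [add_comm, zpow_add_apply]

lemma image_zpow_valueSet (Φ : E ≃L[ℝ] E) {k : ℤ} (hIJ : ∀ i, i ∈ I ↔ i + k ∈ J) :
    (Φ ^ k) '' valueSet Φ D w I = valueSet Φ D w J := by
  ext x
  constructor
  · rintro ⟨_, ⟨ξ, hξ, rfl⟩, rfl⟩
    exact ⟨_, shift_mem_expansionSet hIJ hξ, value_shift Φ k ξ⟩
  · rintro ⟨ξ, hξ, rfl⟩
    have hJI (i : ℤ) : i ∈ J ↔ i + -k ∈ I := by simp [hIJ]
    refine ⟨_, ⟨_, shift_mem_expansionSet hJI hξ, rfl⟩, ?_⟩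
    rw [value_shift, zpow_zpow_neg_apply]

lemma summable_zpow_mul_of_le (hρ : 1 < ρ) (C : ℝ) (b : ℤ) :
    Summable fun j : ℤ => if j ≤ b then ρ ^ j * C else 0 := by
  rw [summable_int_iff_summable_nat_and_neg]
  constructor
  · refine summable_of_hasFiniteSupport ((finite_le_nat b.toNat).subset fun m hm => ?_)
    have : (m : ℤ) ≤ b := by by_contra h; simp [h] at hm
    grind
  · have hgeom : Summable fun m : ℕ => ρ⁻¹ ^ m * |C| :=
      (summable_geometric_of_lt_one (by positivity) (inv_lt_one_of_one_lt₀ hρ)).mul_right _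
    refine hgeom.of_norm_bounded fun m => ?_
    split_ifs
    · rw [zpow_neg, zpow_natCast, norm_mul, norm_inv, norm_pow, inv_pow, Real.norm_eq_abs,
        Real.norm_eq_abs, abs_of_pos (by positivity : 0 < ρ)]
    · rw [norm_zero]; positivity

lemma norm_zpow_digit_le (hρ : 0 < ρ) (hΦ : ∀ x, ‖Φ x‖ = ρ * ‖x‖) {C : ℝ}
    (hC : ∀ d ∈ D, ‖d‖ ≤ C) {b : ℤ} (hI : I ⊆ Iic b) (hξ : ξ ∈ expansionSet D w I) (j : ℤ) :
    ‖(Φ ^ j) (ξ j)‖ ≤ if j ≤ b then ρ ^ j * C else 0 := by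
  split_ifs with h
  · rw [norm_zpow_apply hρ.ne' hΦ]
    gcongr
    exact hC _ (hξ.1.mem j)
  · simp [eq_zero_of_mem_expansionSet hξ fun hj => h (hI hj)]

variable [CompleteSpace E]

lemma summable_value (hρ : 1 < ρ) (hΦ : ∀ x, ‖Φ x‖ = ρ * ‖x‖) (hD : D.Finite) (hI : BddAbove I)
    (hξ : ξ ∈ expansionSet D w I) : Summable fun j : ℤ => (Φ ^ j) (ξ j) := by
  obtain ⟨C, hC⟩ := hD.isBounded.exists_norm_le
  obtain ⟨b, hb⟩ := hI
  exact (summable_zpow_mul_of_le hρ C b).of_norm_bounded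
    (norm_zpow_digit_le (by positivity) hΦ hC (fun _ hi => hb hi) hξ)

lemma value_eq_add_value_update (hρ : 1 < ρ) (hΦ : ∀ x, ‖Φ x‖ = ρ * ‖x‖) (hD : D.Finite)
    (hI : BddAbove I) (hξ : ξ ∈ expansionSet D w I) (i : ℤ) :
    value Φ ξ = (Φ ^ i) (ξ i) + value Φ (Function.update ξ i 0) := by
  rw [value, (summable_value hρ hΦ hD hI hξ).tsum_eq_add_tsum_ite i, value]
  congr 1
  refine tsum_congr fun j => ?_
  rcases eq_or_ne j i with rfl | h
  · simp
  · simp [h]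

lemma image_value_of_digit_eq (hρ : 1 < ρ) (hΦ : ∀ x, ‖Φ x‖ = ρ * ‖x‖) (hD : D.Finite)
    (h0 : (0 : E) ∈ D) (hw : 0 < w) (hI : BddAbove I) {i : ℤ} (hi : i ∈ I) {η : E} (hη : η ∈ D)
    (hη0 : η ≠ 0) :
    value Φ '' {ξ | ξ ∈ expansionSet D w I ∧ ξ i = η}
      = (Φ ^ i) η +ᵥ valueSet Φ D w (I \ Ioo (i - w) (i + w)) := by
  ext x
  simp only [mem_image, mem_vadd_set, valueSet, vadd_eq_add]
  constructor
  · rintro ⟨ξ, ⟨hξ, rfl⟩, rfl⟩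
    exact ⟨_, ⟨_, update_zero_mem_expansionSet h0 hξ hη0, rfl⟩,
      (value_eq_add_value_update hρ hΦ hD hI hξ i).symm⟩
  · rintro ⟨_, ⟨ξ, hξ, rfl⟩, rfl⟩
    have hξi : ξ i = 0 := eq_zero_of_mem_expansionSet hξ fun h => h.2 (by simpa using hw)
    have hmem := update_mem_expansionSet hi hη hξ
    refine ⟨_, ⟨hmem, Function.update_self ..⟩, ?_⟩
    rw [value_eq_add_value_update hρ hΦ hD hI hmem i, Function.update_self, Function.update_idem,
      ← hξi, Function.update_eq_self]

lemma valueSet_eq_union_digit (hρ : 1 < ρ) (hΦ : ∀ x, ‖Φ x‖ = ρ * ‖x‖) (hD : D.Finite)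
    (h0 : (0 : E) ∈ D) (hw : 0 < w) (hI : BddAbove I) {i : ℤ} (hi : i ∈ I) :
    valueSet Φ D w I = valueSet Φ D w (I \ {i}) ∪
      ⋃ η ∈ D \ {0}, (Φ ^ i) η +ᵥ valueSet Φ D w (I \ Ioo (i - w) (i + w)) := by
  have himage {η : E} (hη : η ∈ D \ {0}) :=
    image_value_of_digit_eq hρ hΦ hD h0 hw hI hi hη.1 hη.2
  apply Subset.antisymm
  · rintro _ ⟨ξ, hξ, rfl⟩
    by_cases h : ξ i = 0
    · exact Or.inl ⟨ξ, ⟨hξ.1, fun j hj => ⟨hξ.2 j hj, by rintro rfl; exact hj h⟩⟩, rfl⟩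
    · have hmem : ξ i ∈ D \ {0} := ⟨hξ.1.mem i, h⟩
      exact Or.inr (mem_biUnion hmem (himage hmem ▸ ⟨ξ, ⟨hξ, rfl⟩, rfl⟩))
  · refine union_subset (valueSet_mono sdiff_subset) (iUnion₂_subset fun η hη => ?_)
    rw [← himage hη]
    exact image_mono fun ξ hξ => hξ.1

lemma isCompact_valueSet (hρ : 1 < ρ) (hΦ : ∀ x, ‖Φ x‖ = ρ * ‖x‖) (hD : D.Finite)
    (hI : BddAbove I) : IsCompact (valueSet Φ D w I) := by
  obtain ⟨C, hC⟩ := hD.isBounded.exists_norm_le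
  obtain ⟨b, hb⟩ := hI
  refine (isCompact_expansionSet hD I).image_of_continuousOn ?_
  refine continuousOn_tsum (fun j => ?_) (summable_zpow_mul_of_le hρ C b)
    (fun j ξ hξ => norm_zpow_digit_le (by positivity) hΦ hC (fun _ hi => hb hi) hξ j)
  exact ((Φ ^ j).continuous.comp (continuous_apply j)).continuousOn

lemma valueSet_subset_closure_iUnion (hρ : 1 < ρ) (hΦ : ∀ x, ‖Φ x‖ = ρ * ‖x‖) (hD : D.Finite)
    (h0 : (0 : E) ∈ D) (hI : BddAbove I) :
    valueSet Φ D w I ⊆ closure (⋃ m : ℕ, valueSet Φ D w (I ∩ Ici (-(m : ℤ)))) := by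
  rintro _ ⟨ξ, hξ, rfl⟩
  refine mem_closure_of_tendsto (summable_value hρ hΦ hD hI hξ).hasSum
    (Eventually.of_forall fun s => ?_)
  obtain ⟨a, ha⟩ := s.bddBelow
  have hs : (s : Set ℤ) ⊆ Ici (-((-a).toNat : ℤ)) := fun i hi => by
    have := ha hi
    rw [mem_Ici]
    lia
  have hsum : value Φ (fun i => if i ∈ s then ξ i else 0) = ∑ j ∈ s, (Φ ^ j) (ξ j) := by
    rw [value, tsum_eq_sum (s := s) fun j hj => by simp [hj]]
    exact Finset.sum_congr rfl fun j hj => by simp [hj]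
  exact mem_iUnion.2 ⟨_, _, expansionSet_mono (inter_subset_inter_right I hs)
    (truncate_mem_expansionSet h0 hξ s), hsum⟩

end Values

/-! ### Digit systems and their integer values -/

section DigitSystems

variable {E : Type*} [NormedAddCommGroup E] [NormedSpace ℝ E] {Λ : Submodule ℤ E} {Φ : E ≃L[ℝ] E}
  {ρ : ℝ} {T : Set E} {r R : ℝ} {w : ℕ} {D : Set E}

/-- The geometric part of the set-up: a finite reduced residue digit set inside `Φ ^ w T`, where
`Φ` is a similarity of ratio `ρ > 1` and `T` tiles the space by `Λ`, contains the ball of radius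
`r` and is contained in the ball of radius `R`. The operator norms of `Φ` and `Φ⁻¹` enter only
through `norm_map`. -/
structure DigitSystem (Λ : Submodule ℤ E) (Φ : E ≃L[ℝ] E) (ρ : ℝ) (T : Set E) (r R : ℝ) (w : ℕ)
    (D : Set E) : Prop where
  one_lt : 1 < ρ
  width_pos : 0 < w
  norm_map : ∀ x, ‖Φ x‖ = ρ * ‖x‖
  map_mem : ∀ z ∈ Λ, Φ z ∈ Λ
  digits : IsReducedResidueDigitSet Λ Φ w D
  finite : D.Finite
  r_pos : 0 < r
  R_pos : 0 < R
  closedBall_subset : Metric.closedBall 0 r ⊆ T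
  subset_closedBall : T ⊆ Metric.closedBall 0 R
  ratio_lt : R / r < ρ ^ w - 1
  digits_subset : D ⊆ (Φ ^ w) '' T
  iUnion_eq : ⋃ z ∈ Λ, (z +ᵥ T) = univ
  inter_subset : ∀ z ∈ Λ, z ≠ 0 → T ∩ (z +ᵥ T) ⊆ frontier T

/-- The values of the `m`-digit integers, that is, of the non-adjacent forms supported in
`0, …, m - 1`. -/
def intValues (Φ : E ≃L[ℝ] E) (D : Set E) (w m : ℕ) : Set E := valueSet Φ D w (Ico 0 (m : ℤ))

lemma image_zpow_intValues (Φ : E ≃L[ℝ] E) (D : Set E) (w : ℕ) (a b : ℤ) :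
    (Φ ^ a) '' intValues Φ D w (b - a).toNat = valueSet Φ D w (Ico a b) :=
  image_zpow_valueSet Φ fun i => by simp only [mem_Ico]; lia

namespace DigitSystem

lemma ratio_pos (h : DigitSystem Λ Φ ρ T r R w D) : 0 < ρ := zero_lt_one.trans h.one_lt

lemma pow_sub_one_pos (h : DigitSystem Λ Φ ρ T r R w D) : 0 < ρ ^ w - 1 :=
  (div_pos h.R_pos h.r_pos).trans h.ratio_lt

lemma div_pow_sub_one_lt (h : DigitSystem Λ Φ ρ T r R w D) : R / (ρ ^ w - 1) < r :=
  (div_lt_comm₀ h.r_pos h.pow_sub_one_pos).1 h.ratio_lt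

lemma div_pow_sub_one_pos (h : DigitSystem Λ Φ ρ T r R w D) : 0 < R / (ρ ^ w - 1) :=
  div_pos h.R_pos h.pow_sub_one_pos

lemma div_pow_sub_one_mul_pow (h : DigitSystem Λ Φ ρ T r R w D) :
    R / (ρ ^ w - 1) * ρ ^ w = R / (ρ ^ w - 1) + R := by
  field_simp [h.pow_sub_one_pos.ne']
  ring

lemma le_div_pow_sub_one_mul_pow (h : DigitSystem Λ Φ ρ T r R w D) {k : ℕ} (hk : w ≤ k) :
    R ≤ R / (ρ ^ w - 1) * ρ ^ k :=
  calc R ≤ R / (ρ ^ w - 1) + R := le_add_of_nonneg_left h.div_pow_sub_one_pos.le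
    _ = R / (ρ ^ w - 1) * ρ ^ w := h.div_pow_sub_one_mul_pow.symm
    _ ≤ R / (ρ ^ w - 1) * ρ ^ k :=
      mul_le_mul_of_nonneg_left (pow_le_pow_right₀ h.one_lt.le hk) h.div_pow_sub_one_pos.le

lemma pow_mem (h : DigitSystem Λ Φ ρ T r R w D) (m : ℕ) {z : E} (hz : z ∈ Λ) :
    (Φ ^ m) z ∈ Λ := by
  induction m generalizing z with
  | zero => exact hz
  | succ m ih => rw [pow_succ]; exact ih (h.map_mem z hz)

lemma zpow_mem (h : DigitSystem Λ Φ ρ T r R w D) {k : ℤ} (hk : 0 ≤ k) {z : E} (hz : z ∈ Λ) :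
    (Φ ^ k) z ∈ Λ := by
  lift k to ℕ using hk
  rw [zpow_natCast]
  exact h.pow_mem k hz

lemma norm_zpow (h : DigitSystem Λ Φ ρ T r R w D) (k : ℤ) (x : E) :
    ‖(Φ ^ k) x‖ = ρ ^ k * ‖x‖ :=
  norm_zpow_apply h.ratio_pos.ne' h.norm_map k x

lemma norm_pow (h : DigitSystem Λ Φ ρ T r R w D) (k : ℕ) (x : E) :
    ‖(Φ ^ k) x‖ = ρ ^ k * ‖x‖ := by
  rw [← zpow_natCast, h.norm_zpow, zpow_natCast]

lemma norm_le_of_mem_tile (h : DigitSystem Λ Φ ρ T r R w D) {x : E} (hx : x ∈ T) : ‖x‖ ≤ R := by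
  simpa using h.subset_closedBall hx

lemma norm_digit_le (h : DigitSystem Λ Φ ρ T r R w D) {d : E} (hd : d ∈ D) :
    ‖d‖ ≤ ρ ^ w * R := by
  obtain ⟨t, ht, rfl⟩ := h.digits_subset hd
  rw [h.norm_pow]
  exact mul_le_mul_of_nonneg_left (h.norm_le_of_mem_tile ht) (pow_nonneg h.ratio_pos.le w)

lemma mem_interior_tile (h : DigitSystem Λ Φ ρ T r R w D) {x : E} (hx : ‖x‖ < r) :
    x ∈ interior T :=
  interior_maximal (Metric.ball_subset_closedBall.trans h.closedBall_subset) Metric.isOpen_ball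
    (mem_ball_zero_iff.2 hx)

lemma mem_tile_of_norm_le (h : DigitSystem Λ Φ ρ T r R w D) {x : E}
    (hx : ‖x‖ ≤ R / (ρ ^ w - 1)) : x ∈ T :=
  interior_subset (h.mem_interior_tile (hx.trans_lt h.div_pow_sub_one_lt))

lemma eq_zero_of_norm_tile_sub_lt (h : DigitSystem Λ Φ ρ T r R w D) {p u : E} (hp : p ∈ T)
    (hu : u ∈ Λ) (hpu : ‖p - u‖ < r) : u = 0 := by
  by_contra hu0
  have hinterior := h.mem_interior_tile hpu
  have htranslate : p - u ∈ -u +ᵥ T :=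
    mem_vadd_set.2 ⟨p, hp, by rw [vadd_eq_add, neg_add_eq_sub]⟩
  exact (h.inter_subset (-u) (Λ.neg_mem hu) (neg_ne_zero.2 hu0)
    ⟨interior_subset hinterior, htranslate⟩).2 hinterior

lemma map_pow_width_mem_image (h : DigitSystem Λ Φ ρ T r R w D) {y : E} (hy : y ∈ Λ) :
    (Φ ^ w) y ∈ Φ '' (Λ : Set E) := by
  refine ⟨(Φ ^ (w - 1)) y, h.pow_mem _ hy, ?_⟩
  obtain ⟨v, rfl⟩ := Nat.exists_eq_add_of_lt h.width_pos
  rw [zero_add, Nat.add_sub_cancel, pow_succ']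
  rfl

lemma digit_notMem_image_add (h : DigitSystem Λ Φ ρ T r R w D) {η : E} (hη : η ∈ D \ {0}) {y : E}
    (hy : y ∈ Λ) : η + (Φ ^ w) y ∉ Φ '' (Λ : Set E) := by
  rintro ⟨x, hx, heq⟩
  obtain ⟨z, hz, hzy⟩ := h.map_pow_width_mem_image hy
  refine h.digits.notMem_image η hη.1 hη.2 ⟨x - z, Λ.sub_mem hx hz, ?_⟩
  rw [map_sub, heq, hzy, add_sub_cancel_right]

lemma injOn_digit_add (h : DigitSystem Λ Φ ρ T r R w D) :
    InjOn (fun p : E × E => p.1 + (Φ ^ w) p.2) ((D \ {0}) ×ˢ (Λ : Set E)) := by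
  rintro ⟨η, y⟩ ⟨hη, hy⟩ ⟨η', y'⟩ ⟨hη', hy'⟩ (heq : η + (Φ ^ w) y = η' + (Φ ^ w) y')
  obtain rfl : η = η' := by
    refine (h.digits.existsUnique η (h.digits.subset hη.1)
      (h.digits.notMem_image η hη.1 hη.2)).unique ⟨hη.1, 0, Λ.zero_mem, ?_⟩
      ⟨hη'.1, y' - y, Λ.sub_mem hy' hy, ?_⟩
    · rw [map_zero, sub_self]
    · rw [map_sub, sub_eq_sub_iff_add_eq_add, add_comm, ← heq, add_comm]
  rw [(Φ ^ w).injective (add_left_cancel heq)]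

lemma intValues_zero (h : DigitSystem Λ Φ ρ T r R w D) : intValues Φ D w 0 = {0} := by
  rw [intValues, Nat.cast_zero, Ico_self, valueSet_empty h.digits.zero_mem]

variable [CompleteSpace E]

lemma isCompact_valueSet (h : DigitSystem Λ Φ ρ T r R w D) {I : Set ℤ} (hI : BddAbove I) :
    IsCompact (valueSet Φ D w I) :=
  WNAF.isCompact_valueSet h.one_lt h.norm_map h.finite hI

lemma image_value_of_digit_eq (h : DigitSystem Λ Φ ρ T r R w D) {I : Set ℤ} (hI : BddAbove I)
    {i : ℤ} (hi : i ∈ I) {η : E} (hη : η ∈ D) (hη0 : η ≠ 0) :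
    value Φ '' {ξ | ξ ∈ expansionSet D w I ∧ ξ i = η}
      = (Φ ^ i) η +ᵥ valueSet Φ D w (I \ Ioo (i - w) (i + w)) :=
  WNAF.image_value_of_digit_eq h.one_lt h.norm_map h.finite h.digits.zero_mem h.width_pos hI hi hη
    hη0

lemma valueSet_eq_union_digit (h : DigitSystem Λ Φ ρ T r R w D) {I : Set ℤ} (hI : BddAbove I)
    {i : ℤ} (hi : i ∈ I) :
    valueSet Φ D w I = valueSet Φ D w (I \ {i}) ∪
      ⋃ η ∈ D \ {0}, (Φ ^ i) η +ᵥ valueSet Φ D w (I \ Ioo (i - w) (i + w)) :=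
  WNAF.valueSet_eq_union_digit h.one_lt h.norm_map h.finite h.digits.zero_mem h.width_pos hI hi

lemma intValues_succ_eq_union_highest (h : DigitSystem Λ Φ ρ T r R w D) (m : ℕ) :
    intValues Φ D w (m + 1) = intValues Φ D w m ∪
      ⋃ η ∈ D \ {0}, (Φ ^ m) η +ᵥ intValues Φ D w (m + 1 - w) := by
  have hw := h.width_pos
  have hzero : Ico 0 ((m + 1 : ℕ) : ℤ) \ {(m : ℤ)} = Ico 0 (m : ℤ) := by grind
  have hnonzero : Ico 0 ((m + 1 : ℕ) : ℤ) \ Ioo ((m : ℤ) - w) (m + w)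
      = Ico 0 ((m + 1 - w : ℕ) : ℤ) := by
    ext i; simp only [Set.mem_sdiff, mem_Ico, mem_Ioo]; lia
  rw [intValues, h.valueSet_eq_union_digit bddAbove_Ico (i := m) (by simp), hzero, hnonzero]
  simp only [zpow_natCast, intValues]

lemma intValues_succ_eq_union_lowest (h : DigitSystem Λ Φ ρ T r R w D) (m : ℕ) :
    intValues Φ D w (m + 1) = Φ '' intValues Φ D w m ∪
      ⋃ η ∈ D \ {0}, η +ᵥ (Φ ^ w) '' intValues Φ D w (m + 1 - w) := by
  have hw := h.width_pos
  have hzero : (Φ ^ (1 : ℤ)) '' intValues Φ D w m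
      = valueSet Φ D w (Ico 0 ((m + 1 : ℕ) : ℤ) \ {0}) :=
    image_zpow_valueSet Φ fun i => by
      simp only [Set.mem_sdiff, mem_singleton_iff, mem_Ico]; lia
  have hnonzero : (Φ ^ (w : ℤ)) '' intValues Φ D w (m + 1 - w)
      = valueSet Φ D w (Ico 0 ((m + 1 : ℕ) : ℤ) \ Ioo (0 - (w : ℤ)) (0 + w)) :=
    image_zpow_valueSet Φ fun i => by
      simp only [Set.mem_sdiff, mem_Ico, mem_Ioo]; lia
  rw [zpow_one] at hzero
  rw [zpow_natCast] at hnonzero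
  rw [intValues, h.valueSet_eq_union_digit bddAbove_Ico (i := 0) ⟨le_rfl, by positivity⟩, hzero,
    hnonzero]
  rfl

lemma intValues_subset (h : DigitSystem Λ Φ ρ T r R w D) (m : ℕ) : intValues Φ D w m ⊆ Λ := by
  have hw := h.width_pos
  induction m using Nat.strong_induction_on with
  | _ m ih =>
    rcases m with _ | m
    · rw [h.intValues_zero]
      exact singleton_subset_iff.2 Λ.zero_mem
    · rw [h.intValues_succ_eq_union_highest]
      refine union_subset (ih m (by lia)) (iUnion₂_subset fun η hη => ?_)
      rintro _ ⟨z, hz, rfl⟩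
      exact Λ.add_mem (h.pow_mem m (h.digits.subset hη.1)) (ih _ (by lia) hz)

lemma finite_intValues (h : DigitSystem Λ Φ ρ T r R w D) (m : ℕ) :
    (intValues Φ D w m).Finite := by
  have hw := h.width_pos
  induction m using Nat.strong_induction_on with
  | _ m ih =>
    rcases m with _ | m
    · rw [h.intValues_zero]
      exact finite_singleton 0
    · rw [h.intValues_succ_eq_union_highest]
      exact (ih m (by lia)).union (h.finite.sdiff.biUnion fun η _ => (ih _ (by lia)).image _)

lemma norm_add_le_of_mem_intValues (h : DigitSystem Λ Φ ρ T r R w D) {m k : ℕ}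
    (hk : m ≠ 0 → m + 2 * w ≤ k + 1) (hwk : w ≤ k) {z : E} (hz : z ∈ intValues Φ D w m) :
    ‖z‖ + R ≤ R / (ρ ^ w - 1) * ρ ^ k := by
  have hw := h.width_pos
  have hρ := h.ratio_pos
  induction m using Nat.strong_induction_on generalizing k z with
  | _ m ih =>
    rcases m with _ | m
    · rw [h.intValues_zero, mem_singleton_iff] at hz
      rw [hz, norm_zero, zero_add]
      exact h.le_div_pow_sub_one_mul_pow hwk
    · rw [h.intValues_succ_eq_union_highest] at hz
      rcases hz with hz | hz
      · exact ih m (by lia) (by lia) hwk hz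
      · obtain ⟨η, hη, y, hy, rfl⟩ := mem_iUnion₂.1 hz
        have htail : ‖y‖ + R ≤ R / (ρ ^ w - 1) * ρ ^ (m + w) :=
          ih _ (by lia) (by lia) (by lia) hy
        have hlead : ‖(Φ ^ m) η‖ ≤ ρ ^ m * (ρ ^ w * R) := by
          rw [h.norm_pow]
          exact mul_le_mul_of_nonneg_left (h.norm_digit_le hη.1) (by positivity)
        calc ‖(Φ ^ m) η + y‖ + R ≤ ‖(Φ ^ m) η‖ + (‖y‖ + R) := by
              linarith [norm_add_le ((Φ ^ m) η) y]
          _ ≤ ρ ^ m * (ρ ^ w * R) + R / (ρ ^ w - 1) * ρ ^ (m + w) := add_le_add hlead htail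
          _ = (R / (ρ ^ w - 1) + R) * ρ ^ (m + w) := by ring
          _ = R / (ρ ^ w - 1) * ρ ^ (m + w + w) := by
              rw [← h.div_pow_sub_one_mul_pow]; ring
          _ ≤ R / (ρ ^ w - 1) * ρ ^ k :=
              mul_le_mul_of_nonneg_left (pow_le_pow_right₀ h.one_lt.le (by lia))
                h.div_pow_sub_one_pos.le

lemma ncard_intValues_succ (h : DigitSystem Λ Φ ρ T r R w D) (m : ℕ) :
    (intValues Φ D w (m + 1)).ncard = (intValues Φ D w m).ncard +
      (D \ {0}).ncard * (intValues Φ D w (m + 1 - w)).ncard := by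
  have himage : ⋃ η ∈ D \ {0}, η +ᵥ (Φ ^ w) '' intValues Φ D w (m + 1 - w) =
      (fun p : E × E => p.1 + (Φ ^ w) p.2) '' ((D \ {0}) ×ˢ intValues Φ D w (m + 1 - w)) := by
    ext x
    simp only [mem_iUnion, mem_vadd_set, mem_image, mem_prod, Prod.exists, vadd_eq_add,
      exists_prop]
    grind
  have hdisjoint : Disjoint (Φ '' intValues Φ D w m)
      ((fun p : E × E => p.1 + (Φ ^ w) p.2) '' ((D \ {0}) ×ˢ intValues Φ D w (m + 1 - w))) := by
    rw [Set.disjoint_left]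
    rintro _ ⟨x, hx, rfl⟩ ⟨⟨η, y⟩, ⟨hη, hy⟩, heq⟩
    exact h.digit_notMem_image_add hη (h.intValues_subset _ hy)
      ⟨x, h.intValues_subset _ hx, heq.symm⟩
  rw [h.intValues_succ_eq_union_lowest, himage, ncard_union_eq hdisjoint
    ((h.finite_intValues m).image _) ((h.finite.sdiff.prod (h.finite_intValues _)).image _),
    ncard_image_of_injective _ Φ.injective,
    (h.injOn_digit_add.mono (prod_mono subset_rfl (h.intValues_subset _))).ncard_image, ncard_prod]

/-! ### Lattice points among the values -/

lemma norm_le_of_mem_valueSet (h : DigitSystem Λ Φ ρ T r R w D) {x : E}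
    (hx : x ∈ valueSet Φ D w (Iio (-2 * (w : ℤ) + 1))) : ‖x‖ ≤ R / (ρ ^ w - 1) := by
  have hρ := h.ratio_pos
  suffices hlevels : ⋃ m : ℕ, valueSet Φ D w (Iio (-2 * (w : ℤ) + 1) ∩ Ici (-(m : ℤ)))
      ⊆ Metric.closedBall 0 (R / (ρ ^ w - 1)) from
    mem_closedBall_zero_iff.1 <| closure_minimal hlevels Metric.isClosed_closedBall
      (valueSet_subset_closure_iUnion h.one_lt h.norm_map h.finite h.digits.zero_mem bddAbove_Iio
        hx)
  refine iUnion_subset fun m => ?_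
  rw [inter_comm, Ici_inter_Iio, ← image_zpow_intValues]
  rintro _ ⟨z, hz, rfl⟩
  rw [mem_closedBall_zero_iff]
  rcases le_or_gt (2 * w - 1) m with hm | hm
  · have hw := h.width_pos
    have hle := h.norm_add_le_of_mem_intValues (k := m) (by lia) (by lia) hz
    rw [h.norm_zpow, zpow_neg, zpow_natCast, inv_mul_le_iff₀ (by positivity)]
    linarith [h.R_pos]
  · rw [show (-2 * (w : ℤ) + 1 - -(m : ℤ)).toNat = 0 by lia, h.intValues_zero,
      mem_singleton_iff] at hz
    rw [hz, map_zero, norm_zero]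
    exact h.div_pow_sub_one_pos.le

lemma exists_leading_digit (h : DigitSystem Λ Φ ρ T r R w D) {b : ℤ} {x : E}
    (hx : x ∈ valueSet Φ D w (Iio b)) (hx0 : x ≠ 0) :
    ∃ k < b, ∃ η ∈ D, η ≠ 0 ∧ ∃ y ∈ valueSet Φ D w (Iio (1 - w)), x = (Φ ^ k) (η + y) := by
  have hw := h.width_pos
  obtain ⟨ξ, hξ, rfl⟩ := hx
  obtain ⟨k, hk0, hk⟩ := Int.exists_greatest_of_bdd (P := fun k => ξ k ≠ 0)
    ⟨b, fun z hz => (hξ.2 z hz).le⟩ (by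
      by_contra! hzero
      exact hx0 (by simp [value, hzero]))
  refine ⟨k, hξ.2 k hk0, ξ k, hξ.1.mem k, hk0, ?_⟩
  have hmem : value Φ ξ ∈ value Φ '' {ξ' | ξ' ∈ expansionSet D w (Iio (k + 1)) ∧ ξ' k = ξ k} :=
    ⟨ξ, ⟨⟨hξ.1, fun i hi => Int.lt_add_one_of_le (hk i hi)⟩, rfl⟩, rfl⟩
  have hshift (i : ℤ) : i ∈ Iio (1 - (w : ℤ)) ↔ i + k ∈ Iio (k + 1) \ Ioo (k - w) (k + w) := by
    simp only [Set.mem_sdiff, mem_Iio, mem_Ioo]; lia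
  rw [h.image_value_of_digit_eq bddAbove_Iio (by simp) (hξ.1.mem k) hk0,
    ← image_zpow_valueSet Φ hshift] at hmem
  obtain ⟨_, ⟨y, hy, rfl⟩, hxy⟩ := hmem
  exact ⟨y, hy, hxy.symm.trans (map_add (Φ ^ k) (ξ k) y).symm⟩

lemma norm_zpow_neg_width_lt (h : DigitSystem Λ Φ ρ T r R w D) {y : E}
    (hy : y ∈ valueSet Φ D w (Iio (1 - w))) : ‖(Φ ^ (-(w : ℤ))) y‖ < r := by
  refine (h.norm_le_of_mem_valueSet ?_).trans_lt h.div_pow_sub_one_lt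
  rw [← image_zpow_valueSet Φ (k := -(w : ℤ)) (I := Iio (1 - w))
    fun i => by simp only [mem_Iio]; lia]
  exact mem_image_of_mem _ hy

lemma eq_zero_of_mem_valueSet_Iio_one_sub (h : DigitSystem Λ Φ ρ T r R w D)
    {x : E} (hx : x ∈ valueSet Φ D w (Iio (1 - w))) (hxΛ : x ∈ Λ) : x = 0 := by
  by_contra hx0
  obtain ⟨k, hk, η, hη, hη0, y, hy, rfl⟩ := h.exists_leading_digit hx hx0
  obtain ⟨t, ht, rfl⟩ := h.digits_subset hη
  have hscaled : (Φ ^ (-k - w)) ((Φ ^ k) ((Φ ^ w) t + y)) = t + (Φ ^ (-(w : ℤ))) y := by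
    rw [← zpow_add_apply, show -k - w + k = -(w : ℤ) by ring, map_add, ← zpow_natCast,
      zpow_neg_zpow_apply]
  -- the scaled point is a lattice point within distance `r` of the tile point `t`
  have hvanish : t + (Φ ^ (-(w : ℤ))) y = 0 := by
    refine h.eq_zero_of_norm_tile_sub_lt ht (hscaled ▸ h.zpow_mem (by lia) hxΛ) ?_
    rw [sub_add_cancel_left, norm_neg]
    exact h.norm_zpow_neg_width_lt hy
  exact hx0 ((Φ ^ (-k - w)).injective (by rw [hscaled, hvanish, map_zero]))

lemma eq_zero_of_mem_valueSet_Iio_zero (h : DigitSystem Λ Φ ρ T r R w D)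
    {x : E} (hx : x ∈ valueSet Φ D w (Iio 0)) (hxΛ : x ∈ Λ) : x = 0 := by
  by_contra hx0
  obtain ⟨k, hk, η, hη, hη0, y, hy, rfl⟩ := h.exists_leading_digit hx hx0
  have hscaled : (Φ ^ (-k)) ((Φ ^ k) (η + y)) = η + y := zpow_neg_zpow_apply Φ k _
  have hηy : η + y ∈ Λ := hscaled ▸ h.zpow_mem (by lia) hxΛ
  have hy0 : y = 0 := h.eq_zero_of_mem_valueSet_Iio_one_sub hy
    (by simpa using Λ.sub_mem hηy (h.digits.subset hη))
  refine h.digits.notMem_image η hη hη0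
    ⟨(Φ ^ (-k - 1)) ((Φ ^ k) (η + y)), h.zpow_mem (by lia) hxΛ, ?_⟩
  rw [← zpow_one_apply Φ, ← zpow_add_apply, add_sub_cancel, hscaled, hy0, add_zero]

lemma mem_intValues_of_mem_lattice (h : DigitSystem Λ Φ ρ T r R w D) (m : ℕ)
    {x : E} (hx : x ∈ valueSet Φ D w (Iio m)) (hxΛ : x ∈ Λ) : x ∈ intValues Φ D w m := by
  have hw := h.width_pos
  induction m using Nat.strong_induction_on generalizing x with
  | _ m ih =>
    rcases m with _ | m
    · rw [h.intValues_zero]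
      exact h.eq_zero_of_mem_valueSet_Iio_zero (by simpa using hx) hxΛ
    · rw [h.valueSet_eq_union_digit bddAbove_Iio (i := m) (by simp)] at hx
      rw [h.intValues_succ_eq_union_highest]
      rcases hx with hx | hx
      · refine Or.inl (ih m (by lia) (valueSet_mono (fun i => ?_) hx) hxΛ)
        simp only [Set.mem_sdiff, mem_Iio, mem_singleton_iff]; lia
      · obtain ⟨η, hη, y, hy, rfl⟩ := mem_iUnion₂.1 hx
        rw [zpow_natCast] at hxΛ ⊢
        refine Or.inr (mem_iUnion₂.2 ⟨η, hη, y, ih _ (by lia) (valueSet_mono (fun i => ?_) hy) ?_,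
          rfl⟩)
        · simp only [Set.mem_sdiff, mem_Iio, mem_Ioo]; lia
        · simpa using Λ.sub_mem hxΛ (h.pow_mem m (h.digits.subset hη.1))

/-! ### Characteristic sets and their approximations -/

lemma charSet_eq_vadd_valueSet (h : DigitSystem Λ Φ ρ T r R w D) {η : E} (hη : η ∈ D)
    (hη0 : η ≠ 0) :
    charSet Φ D w η = (Φ ^ (-(w : ℤ))) η +ᵥ valueSet Φ D w (Iio (-2 * (w : ℤ) + 1)) := by
  have hw := h.width_pos
  rw [charSet, wnafSet_zero_top, h.image_value_of_digit_eq bddAbove_Iio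
    (by simp only [mem_Iio]; lia) hη hη0]
  congr 2
  ext i; simp only [Set.mem_sdiff, mem_Iio, mem_Ioo]; lia

lemma charSet_eq_vadd_image_fundDomain (h : DigitSystem Λ Φ ρ T r R w D) {η : E} (hη : η ∈ D)
    (hη0 : η ≠ 0) :
    charSet Φ D w η
      = (Φ ^ (-(w : ℤ))) η +ᵥ (Φ ^ (-2 * (w : ℤ) + 1)) '' fundDomain Φ D w := by
  rw [h.charSet_eq_vadd_valueSet hη hη0, fundDomain_eq_valueSet, image_zpow_valueSet]
  simp only [mem_Iio]
  lia

lemma charSetLevel_eq_vadd_valueSet (h : DigitSystem Λ Φ ρ T r R w D) {η : E}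
    (hη : η ∈ D) (hη0 : η ≠ 0) (j : ℕ) :
    charSetLevel Φ D w η j = (Φ ^ (-(w : ℤ))) η +ᵥ
      valueSet Φ D w (Ico (-((j : ℤ) + w)) (-2 * (w : ℤ) + 1)) := by
  have hw := h.width_pos
  rw [charSetLevel, wnafSet_zero_natCast, h.image_value_of_digit_eq bddAbove_Ico
    (by simp only [mem_Ico]; lia) hη hη0]
  congr 2
  ext i; simp only [Set.mem_sdiff, mem_Ico, mem_Ioo]; lia

lemma charSetLevel_eq_image_intValues (h : DigitSystem Λ Φ ρ T r R w D) {η : E}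
    (hη : η ∈ D) (hη0 : η ≠ 0) (j : ℕ) :
    charSetLevel Φ D w η j
      = (Φ ^ (-((j : ℤ) + w))) '' ((Φ ^ j) η +ᵥ intValues Φ D w (j + 1 - w)) := by
  rw [h.charSetLevel_eq_vadd_valueSet hη hη0, ← image_zpow_intValues, image_vadd_distrib,
    ← zpow_natCast, ← zpow_add_apply]
  congr 3
  · ring
  · lia

lemma charApprox_eq_image_iUnion (h : DigitSystem Λ Φ ρ T r R w D) {η : E} (hη : η ∈ D)
    (hη0 : η ≠ 0) (j : ℕ) :
    charApprox Λ T Φ D w η j = (Φ ^ (-((j : ℤ) + w))) ''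
      ⋃ z ∈ (Φ ^ j) η +ᵥ intValues Φ D w (j + 1 - w), (z +ᵥ T) := by
  have hlattice : (Φ ^ j) η +ᵥ intValues Φ D w (j + 1 - w) ⊆ Λ := by
    rintro _ ⟨z, hz, rfl⟩
    exact Λ.add_mem (h.pow_mem j (h.digits.subset hη)) (h.intValues_subset _ hz)
  rw [charApprox, cellCoverAt, h.charSetLevel_eq_image_intValues hη hη0, image_zpow_image,
    add_neg_cancel, image_zpow_zero, cellCover, inter_eq_left.2 hlattice]

lemma norm_sub_le_of_mem_charSet (h : DigitSystem Λ Φ ρ T r R w D) {η : E} (hη : η ∈ D)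
    (hη0 : η ≠ 0) {x : E} (hx : x ∈ charSet Φ D w η) :
    ‖x - (Φ ^ (-(w : ℤ))) η‖ ≤ R / (ρ ^ w - 1) := by
  rw [h.charSet_eq_vadd_valueSet hη hη0] at hx
  obtain ⟨y, hy, rfl⟩ := hx
  simpa using h.norm_le_of_mem_valueSet hy

lemma norm_sub_le_of_mem_charApprox (h : DigitSystem Λ Φ ρ T r R w D) {η : E} (hη : η ∈ D)
    (hη0 : η ≠ 0) {j : ℕ} {x : E} (hx : x ∈ charApprox Λ T Φ D w η j) :
    ‖x - (Φ ^ (-(w : ℤ))) η‖ ≤ R / (ρ ^ w - 1) := by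
  have hρ := h.ratio_pos
  rw [h.charApprox_eq_image_iUnion hη hη0] at hx
  obtain ⟨x, hx, rfl⟩ := hx
  obtain ⟨_, ⟨z, hz, rfl⟩, t, ht, rfl⟩ := mem_iUnion₂.1 hx
  have hcenter : (Φ ^ (-((j : ℤ) + w))) ((Φ ^ j) η + z + t) - (Φ ^ (-(w : ℤ))) η
      = (Φ ^ (-((j : ℤ) + w))) (z + t) := by
    rw [add_assoc, map_add, ← zpow_natCast, ← zpow_add_apply,
      show -((j : ℤ) + w) + j = -w by ring, add_sub_cancel_left]
  change ‖(Φ ^ (-((j : ℤ) + w))) ((Φ ^ j) η + z + t) - (Φ ^ (-(w : ℤ))) η‖ ≤ _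
  rw [hcenter, h.norm_zpow, zpow_neg, ← Nat.cast_add, zpow_natCast,
    inv_mul_le_iff₀ (by positivity), mul_comm]
  calc ‖z + t‖ ≤ ‖z‖ + R := (norm_add_le _ _).trans (by gcongr; exact h.norm_le_of_mem_tile ht)
    _ ≤ R / (ρ ^ w - 1) * ρ ^ (j + w) :=
      h.norm_add_le_of_mem_intValues (by lia) (by lia) hz

lemma image_sub_charSet_subset_tile (h : DigitSystem Λ Φ ρ T r R w D) {η : E} (hη : η ∈ D)
    (hη0 : η ≠ 0) : (fun x => x - (Φ ^ (-(w : ℤ))) η) '' charSet Φ D w η ⊆ T := by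
  rintro _ ⟨x, hx, rfl⟩
  exact h.mem_tile_of_norm_le (h.norm_sub_le_of_mem_charSet hη hη0 hx)

lemma image_sub_charApprox_subset_tile (h : DigitSystem Λ Φ ρ T r R w D) {η : E} (hη : η ∈ D)
    (hη0 : η ≠ 0) (j : ℕ) :
    (fun x => x - (Φ ^ (-(w : ℤ))) η) '' charApprox Λ T Φ D w η j ⊆ T := by
  rintro _ ⟨x, hx, rfl⟩
  exact h.mem_tile_of_norm_le (h.norm_sub_le_of_mem_charApprox hη hη0 hx)

end DigitSystem
end DigitSystems

/-! ### Linear recurrences with small characteristic roots -/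

section LinearRecurrences

open Polynomial

variable {𝕜 F : Type*} [NormedField 𝕜] [NormedAddCommGroup F] [NormedSpace 𝕜 F]

/-- The shift operator on sequences. A linear recurrence with characteristic polynomial `P` for
the sequence `e` is the equation `aeval (seqShift 𝕜 F) P e = 0`. -/
def seqShift (R M : Type*) [CommSemiring R] [AddCommMonoid M] [Module R M] :
    Module.End R (ℕ → M) :=
  LinearMap.funLeft R M Nat.succ

lemma seqShift_pow_apply {R M : Type*} [CommSemiring R] [AddCommMonoid M] [Module R M] (i : ℕ)
    (e : ℕ → M) (k : ℕ) : (seqShift R M ^ i) e k = e (k + i) := by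
  induction i generalizing e with
  | zero => rfl
  | succ i ih => rw [pow_succ, Module.End.mul_apply, ih]; rfl

lemma exists_norm_le_of_norm_sub_smul_le {μ : ℝ} (hμ : 0 < μ) {α : 𝕜} (hα : ‖α‖ < μ)
    {b : ℕ → F} {C : ℝ} (hb : ∀ k, ‖b (k + 1) - α • b k‖ ≤ C * μ ^ k) :
    ∃ C', ∀ k, ‖b k‖ ≤ C' * μ ^ k := by
  have hC : 0 ≤ C := by simpa using (norm_nonneg _).trans (hb 0)
  have hgap : 0 < μ - ‖α‖ := sub_pos.2 hα
  set C' := ‖b 0‖ + C / (μ - ‖α‖)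
  have hCC' : C ≤ (μ - ‖α‖) * C' := by
    rw [mul_add, mul_div_cancel₀ _ hgap.ne']
    exact le_add_of_nonneg_left (mul_nonneg hgap.le (norm_nonneg _))
  refine ⟨C', fun k => ?_⟩
  induction k with
  | zero =>
    rw [pow_zero, mul_one]
    exact le_add_of_nonneg_right (div_nonneg hC hgap.le)
  | succ k ih =>
    calc ‖b (k + 1)‖ = ‖(b (k + 1) - α • b k) + α • b k‖ := by rw [sub_add_cancel]
      _ ≤ C * μ ^ k + ‖α‖ * (C' * μ ^ k) := by
        refine (norm_add_le _ _).trans (add_le_add (hb k) ?_)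
        rw [norm_smul]
        gcongr
      _ ≤ (μ - ‖α‖) * C' * μ ^ k + ‖α‖ * (C' * μ ^ k) := by gcongr
      _ = C' * μ ^ (k + 1) := by ring

lemma exists_norm_le_of_aeval_prod_le {μ : ℝ} (hμ : 0 < μ) (s : Multiset 𝕜)
    (hs : ∀ α ∈ s, ‖α‖ < μ) (e : ℕ → F) {C : ℝ}
    (he : ∀ k, ‖aeval (seqShift 𝕜 F) (s.map fun α => X - Polynomial.C α).prod e k‖ ≤ C * μ ^ k) :
    ∃ C', ∀ k, ‖e k‖ ≤ C' * μ ^ k := by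
  induction s using Multiset.induction_on generalizing C with
  | empty => exact ⟨C, fun k => by simpa using he k⟩
  | cons α s ih =>
    simp only [Multiset.map_cons, Multiset.prod_cons, map_mul, Module.End.mul_apply, map_sub,
      aeval_X, aeval_C] at he
    obtain ⟨C', hC'⟩ :=
      exists_norm_le_of_norm_sub_smul_le hμ (hs α (Multiset.mem_cons_self α s)) he
    exact ih (fun β hβ => hs β (Multiset.mem_cons_of_mem hβ)) hC'

lemma exists_norm_le_of_aeval_seqShift_eq_zero {μ : ℝ} (hμ : 0 < μ) {P : 𝕜[X]} (hP : P ≠ 0)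
    (hsplits : P.Splits) (hroots : ∀ α, P.eval α = 0 → ‖α‖ < μ) {e : ℕ → F}
    (he : aeval (seqShift 𝕜 F) P e = 0) : ∃ C, ∀ k, ‖e k‖ ≤ C * μ ^ k := by
  refine exists_norm_le_of_aeval_prod_le (C := 0) hμ P.roots
    (fun α hα => hroots α (isRoot_of_mem_roots hα)) e fun k => ?_
  rw [hsplits.eq_prod_roots, map_mul, Module.End.mul_apply, aeval_C,
    Module.algebraMap_end_apply] at he
  rw [(smul_eq_zero.1 he).resolve_left (leadingCoeff_ne_zero.2 hP)]
  simp

end LinearRecurrences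

/-! ### The characteristic roots of the counting recurrence -/

section CharacteristicRoots

lemma one_le_norm_of_root {p : ℝ} (hp0 : 0 < p) (hp1 : p < 1) {w : ℕ} {y : ℂ}
    (hy : p * y + (1 - p) * y ^ w = 1) : 1 ≤ ‖y‖ := by
  by_contra! hlt
  have htriangle : ‖(p : ℂ) * y + (1 - p) * y ^ w‖ ≤ p * ‖y‖ + (1 - p) * ‖y‖ ^ w := by
    refine (norm_add_le _ _).trans_eq ?_
    rw [norm_mul, norm_mul, norm_pow, ← Complex.ofReal_one, ← Complex.ofReal_sub,
      Complex.norm_of_nonneg hp0.le, Complex.norm_of_nonneg (sub_pos.2 hp1).le]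
  rw [hy, norm_one] at htriangle
  have hpow : ‖y‖ ^ w ≤ 1 := pow_le_one₀ (norm_nonneg _) hlt.le
  nlinarith

lemma sq_pow_le_one_add {w : ℕ} {s : ℝ} (hs : 1 ≤ s) (hws : w * (s - 1) ≤ 1 / 8) :
    (s ^ w) ^ 2 ≤ 1 + 5 / 2 * (w * (s - 1)) := by
  set x := 2 * (w * (s - 1)) with hx
  have hx0 : 0 ≤ x := by have := sub_nonneg.2 hs; positivity
  have hpow_le_exp : (s ^ w) ^ 2 ≤ Real.exp x := by
    rw [← pow_mul, mul_comm w 2, show x = ((2 * w : ℕ) : ℝ) * (s - 1) by push_cast; ring,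
      Real.exp_nat_mul]
    have : s ≤ Real.exp (s - 1) := by simpa using Real.add_one_le_exp (s - 1)
    gcongr
  have hexp := (abs_le.1 (Real.abs_exp_sub_one_sub_id_le (x := x)
    (by rw [abs_of_nonneg hx0]; linarith))).2
  nlinarith only [hpow_le_exp, hexp, hws, hx0, hx]

lemma two_mul_one_sub_le_of_modulus_eq {p : ℝ} (hp : 0 ≤ p) {w : ℕ} {s c : ℝ} (hs : 1 ≤ s)
    (hws : w * (s - 1) ≤ 1 / 8) (hc : c ≤ 1)
    (hmodulus : ((1 - p) * s ^ w) ^ 2 = 1 - 2 * p * (s * c) + (p * s) ^ 2) :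
    2 * p * (1 - c) ≤ (1 - p) ^ 2 * (5 / 2 * (w * (s - 1))) + 2 * p * (1 - p) * (s - 1) := by
  have hpow : ((1 - p) * s ^ w) ^ 2 ≤ (1 - p) ^ 2 * (1 + 5 / 2 * (w * (s - 1))) := by
    rw [mul_pow]
    gcongr
    exact sq_pow_le_one_add hs hws
  have hnonneg : 0 ≤ 2 * p * (s - 1) * (1 - c) := by
    have := sub_nonneg.2 hc
    have := sub_nonneg.2 hs
    positivity
  nlinarith only [hpow, hmodulus, hnonneg, sq_nonneg (p * (s - 1))]

lemma one_sub_mul_sq_le_of_modulus_eq {p : ℝ} (hp0 : 0 < p) (hp1 : p ≤ 1 / 2) {w : ℕ}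
    (hw : 2 ≤ w) {s c : ℝ} (hs : 1 ≤ s) (hsw : s ≤ 1 + p / (w : ℝ) ^ 3) (hc : c ≤ 1)
    (hmodulus : ((1 - p) * s ^ w) ^ 2 = 1 - 2 * p * (s * c) + (p * s) ^ 2) :
    (1 - c) * (w : ℝ) ^ 2 ≤ 5 / 4 := by
  have hw2 : (2 : ℝ) ≤ w := by exact_mod_cast hw
  have : 0 ≤ s - 1 := sub_nonneg.2 hs
  have hδ3 : (s - 1) * (w : ℝ) ^ 3 ≤ p := by
    rw [← le_div_iff₀ (by positivity)]
    linarith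
  have hδ2 : (s - 1) * (w : ℝ) ^ 2 * 2 ≤ p := by
    have : (s - 1) * (w : ℝ) ^ 2 * 2 ≤ (s - 1) * (w : ℝ) ^ 2 * w := by gcongr
    linarith
  have hδ1 : w * (s - 1) ≤ 1 / 8 := by
    have : w * (s - 1) * 4 ≤ w * (s - 1) * (w : ℝ) ^ 2 := by
      have : (4 : ℝ) ≤ (w : ℝ) ^ 2 := by nlinarith only [hw2]
      gcongr
    linarith
  have hscaled : p * (2 * ((1 - c) * (w : ℝ) ^ 2)) ≤ p * (5 / 2) :=
    calc p * (2 * ((1 - c) * (w : ℝ) ^ 2)) = 2 * p * (1 - c) * (w : ℝ) ^ 2 := by ring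
      _ ≤ ((1 - p) ^ 2 * (5 / 2 * (w * (s - 1))) + 2 * p * (1 - p) * (s - 1)) * (w : ℝ) ^ 2 := by
        gcongr
        exact two_mul_one_sub_le_of_modulus_eq hp0.le hs hδ1 hc hmodulus
      _ = (1 - p) ^ 2 * (5 / 2) * ((s - 1) * (w : ℝ) ^ 3)
          + p * (1 - p) * ((s - 1) * (w : ℝ) ^ 2 * 2) := by ring
      _ ≤ (1 - p) ^ 2 * (5 / 2) * p + p * (1 - p) * p := by
        have : 0 ≤ 1 - p := by linarith
        gcongr
      _ ≤ p * (5 / 2) := by nlinarith only [mul_pos hp0 hp0, hp1]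
  linarith only [le_of_mul_le_mul_left hscaled hp0]

lemma abs_mul_lt_pi_of_one_sub_cos_mul_sq_le {x θ : ℝ} (hθ : |θ| ≤ Real.pi)
    (hcos : (1 - Real.cos θ) * x ^ 2 ≤ 5 / 4) : |x * θ| < Real.pi := by
  have hpi := Real.pi_pos
  have hquad : 2 / Real.pi ^ 2 * (x * θ) ^ 2 ≤ 5 / 4 :=
    calc 2 / Real.pi ^ 2 * (x * θ) ^ 2 = 2 / Real.pi ^ 2 * θ ^ 2 * x ^ 2 := by ring
      _ ≤ (1 - Real.cos θ) * x ^ 2 := by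
        gcongr
        linarith [Real.cos_le_one_sub_mul_cos_sq hθ]
      _ ≤ 5 / 4 := hcos
  rw [div_mul_eq_mul_div, div_le_iff₀ (by positivity)] at hquad
  refine abs_lt_of_sq_lt_sq ?_ hpi.le
  nlinarith only [hquad, hpi]

lemma eq_zero_of_mul_sin_add_mul_sin_eq_zero {a b x θ : ℝ} (ha : 0 < a) (hb : 0 < b)
    (hx : 1 ≤ x) (hθ : |x * θ| < Real.pi) (hsin : a * Real.sin θ + b * Real.sin (x * θ) = 0) :
    θ = 0 := by
  have not_pos : ∀ φ : ℝ, |x * φ| < Real.pi → a * Real.sin φ + b * Real.sin (x * φ) = 0 →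
      ¬0 < φ := by
    intro φ hφ hsum hpos
    have hxφ := (abs_lt.1 hφ).2
    have hsinφ : 0 < Real.sin φ :=
      Real.sin_pos_of_pos_of_lt_pi hpos ((le_mul_of_one_le_left hpos.le hx).trans_lt hxφ)
    have hsinxφ : 0 < Real.sin (x * φ) :=
      Real.sin_pos_of_pos_of_lt_pi (mul_pos (zero_lt_one.trans_le hx) hpos) hxφ
    exact (add_pos (mul_pos ha hsinφ) (mul_pos hb hsinxφ)).ne' hsum
  refine le_antisymm (not_lt.1 (not_pos θ hθ hsin)) (neg_nonpos.1 (not_lt.1 (not_pos (-θ) ?_ ?_)))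
  · rwa [mul_neg, abs_neg]
  · rw [mul_neg, Real.sin_neg, Real.sin_neg]
    linarith

lemma pow_eq_norm_pow_mul_cos_add_sin_mul_I (y : ℂ) (w : ℕ) :
    y ^ w = ((‖y‖ ^ w * Real.cos (w * y.arg) : ℝ) : ℂ)
      + ((‖y‖ ^ w * Real.sin (w * y.arg) : ℝ) : ℂ) * Complex.I := by
  conv_lhs => rw [← Complex.norm_mul_cos_add_sin_mul_I y]
  rw [mul_pow, Complex.cos_add_sin_mul_I_pow]
  push_cast
  ring

lemma re_pow_eq_norm_pow_mul_cos (y : ℂ) (w : ℕ) :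
    (y ^ w).re = ‖y‖ ^ w * Real.cos (w * y.arg) := by
  rw [pow_eq_norm_pow_mul_cos_add_sin_mul_I, Complex.add_re, Complex.ofReal_re,
    Complex.re_ofReal_mul, Complex.I_re, mul_zero, add_zero]

lemma im_pow_eq_norm_pow_mul_sin (y : ℂ) (w : ℕ) :
    (y ^ w).im = ‖y‖ ^ w * Real.sin (w * y.arg) := by
  rw [pow_eq_norm_pow_mul_cos_add_sin_mul_I, Complex.add_im, Complex.ofReal_im,
    Complex.im_ofReal_mul, Complex.I_im, mul_one, zero_add]

/-- A root of modulus close to `1` has an argument too small for the imaginary parts of `p * y`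
and `(1 - p) * y ^ w` to cancel. -/
lemma eq_one_of_root {p : ℝ} (hp0 : 0 < p) (hp1 : p ≤ 1 / 2) {w : ℕ} (hw : 2 ≤ w) {y : ℂ}
    (hy : p * y + (1 - p) * y ^ w = 1) (hyw : ‖y‖ ≤ 1 + p / (w : ℝ) ^ 3) : y = 1 := by
  have hp' : 0 < 1 - p := by linarith
  have hs : 1 ≤ ‖y‖ := one_le_norm_of_root hp0 (by linarith) hy
  have hs0 : 0 < ‖y‖ := zero_lt_one.trans_le hs
  rw [show (1 - (p : ℂ)) = ((1 - p : ℝ) : ℂ) by push_cast; rfl] at hy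
  have hre : p * (‖y‖ * Real.cos y.arg) + (1 - p) * (‖y‖ ^ w * Real.cos (w * y.arg)) = 1 := by
    rw [Complex.norm_mul_cos_arg, ← re_pow_eq_norm_pow_mul_cos, ← Complex.re_ofReal_mul,
      ← Complex.re_ofReal_mul, ← Complex.add_re, hy, Complex.one_re]
  have him : p * (‖y‖ * Real.sin y.arg) + (1 - p) * (‖y‖ ^ w * Real.sin (w * y.arg)) = 0 := by
    rw [Complex.norm_mul_sin_arg, ← im_pow_eq_norm_pow_mul_sin, ← Complex.im_ofReal_mul,
      ← Complex.im_ofReal_mul, ← Complex.add_im, hy, Complex.one_im]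
  have hmodulus : ((1 - p) * ‖y‖ ^ w) ^ 2
      = 1 - 2 * p * (‖y‖ * Real.cos y.arg) + (p * ‖y‖) ^ 2 := by
    linear_combination (p * ‖y‖) ^ 2 * Real.sin_sq_add_cos_sq y.arg
      - ((1 - p) * ‖y‖ ^ w) ^ 2 * Real.sin_sq_add_cos_sq (w * y.arg)
      + ((1 - p) * (‖y‖ ^ w * Real.cos (w * y.arg)) + 1 - p * (‖y‖ * Real.cos y.arg)) * hre
      + ((1 - p) * (‖y‖ ^ w * Real.sin (w * y.arg)) - p * (‖y‖ * Real.sin y.arg)) * him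
  have harg : y.arg = 0 :=
    eq_zero_of_mul_sin_add_mul_sin_eq_zero (mul_pos hp0 hs0) (mul_pos hp' (pow_pos hs0 w))
      (Nat.one_le_cast.2 (one_le_two.trans hw))
      (abs_mul_lt_pi_of_one_sub_cos_mul_sq_le (Complex.abs_arg_le_pi y)
        (one_sub_mul_sq_le_of_modulus_eq hp0 hp1 hw hs hyw (Real.cos_le_one _) hmodulus))
      (by linarith only [him])
  rw [harg, mul_zero, Real.cos_zero] at hre
  have hnorm : ‖y‖ = 1 := by
    have := one_le_pow₀ hs (n := w)
    nlinarith only [hre, this, hs, hp0, hp']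
  rw [← Complex.norm_mul_cos_add_sin_mul_I y, hnorm, harg]
  simp

open Polynomial in
/-- The characteristic polynomial `X ^ (v + 1) - p X ^ v - (1 - p)` of the counting recurrence,
divided by `X - 1`. -/
noncomputable def charPoly (p : ℝ) (v : ℕ) : ℂ[X] :=
  X ^ v + C (1 - p : ℂ) * ∑ i ∈ Finset.range v, X ^ i

lemma eval_charPoly (p : ℝ) (v : ℕ) (x : ℂ) :
    (charPoly p v).eval x = x ^ v + (1 - p) * ∑ i ∈ Finset.range v, x ^ i := by
  simp [charPoly, Polynomial.eval_finsetSum]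

lemma eval_charPoly_mul_sub_one (p : ℝ) (v : ℕ) (x : ℂ) :
    (charPoly p v).eval x * (x - 1) = x ^ (v + 1) - p * x ^ v - (1 - p) := by
  rw [eval_charPoly]
  linear_combination (1 - p : ℂ) * geom_sum_mul x v

lemma aeval_seqShift_charPoly_apply (p : ℝ) (v : ℕ) (e : ℕ → ℂ) (k : ℕ) :
    Polynomial.aeval (seqShift ℂ ℂ) (charPoly p v) e k
      = e (k + v) + (1 - p) * ∑ i ∈ Finset.range v, e (k + i) := by
  simp [charPoly, seqShift_pow_apply, Finset.mul_sum, sub_mul]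

lemma one_add_mul_natCast_pos {p : ℝ} (hp1 : p ≤ 1 / 2) (v : ℕ) : 0 < 1 + (1 - p) * (v : ℝ) :=
  add_pos_of_pos_of_nonneg one_pos (mul_nonneg (by linarith) v.cast_nonneg)

lemma eval_one_charPoly_ne_zero {p : ℝ} (hp1 : p ≤ 1 / 2) (v : ℕ) :
    (charPoly p v).eval 1 ≠ 0 := by
  rw [eval_charPoly]
  simp only [one_pow, Finset.sum_const, Finset.card_range, nsmul_eq_mul, mul_one]
  exact_mod_cast (one_add_mul_natCast_pos hp1 v).ne'

lemma norm_root_charPoly_lt {p : ℝ} (hp0 : 0 < p) (hp1 : p ≤ 1 / 2) (v : ℕ) {x : ℂ}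
    (hx : (charPoly p v).eval x = 0) : ‖x‖ < (1 + p / ((v + 1 : ℕ) : ℝ) ^ 3)⁻¹ := by
  have hμ : (0 : ℝ) < 1 + p / ((v + 1 : ℕ) : ℝ) ^ 3 := by positivity
  obtain rfl | hv := Nat.eq_zero_or_pos v
  · simp [charPoly] at hx
  by_contra! hle
  have hx0 : x ≠ 0 := norm_pos_iff.1 ((inv_pos.2 hμ).trans_le hle)
  have hroot : x ^ (v + 1) - p * x ^ v - (1 - p) = 0 := by
    rw [← eval_charPoly_mul_sub_one, hx, zero_mul]
  have hinv : p * x⁻¹ + (1 - p) * x⁻¹ ^ (v + 1) = 1 := by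
    rw [inv_pow]
    field_simp
    linear_combination -x * hroot
  have hx1 : x = 1 := inv_eq_one.1 (eq_one_of_root hp0 hp1 (by lia) hinv
    (by rw [norm_inv]; exact inv_le_of_inv_le₀ hμ hle))
  exact eval_one_charPoly_ne_zero hp1 v (hx1 ▸ hx)

end CharacteristicRoots

/-! ### The counting recurrence -/

section CountingRecurrence

lemma add_sum_range_eq_of_recurrence {A : Type*} [CommRing A] {p : A} {v : ℕ} {a : ℕ → A}
    (ha : ∀ k, a (k + v + 1) = p * a (k + v) + (1 - p) * a k) (k : ℕ) :
    a (k + v) + (1 - p) * ∑ i ∈ Finset.range v, a (k + i)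
      = a v + (1 - p) * ∑ i ∈ Finset.range v, a i := by
  induction k with
  | zero => simp only [zero_add]
  | succ k ih =>
    have hslide : ∑ i ∈ Finset.range v, a (k + 1 + i) + a k
        = ∑ i ∈ Finset.range v, a (k + i) + a (k + v) := by
      rw [← Finset.sum_range_succ, Finset.sum_range_succ']
      simp only [add_zero, add_assoc, add_comm 1]
    rw [← ih, show k + 1 + v = k + v + 1 by lia, ha]
    linear_combination (1 - p) * hslide

lemma exists_abs_sub_le_of_recurrence {p : ℝ} (hp0 : 0 < p) (hp1 : p ≤ 1 / 2) {v : ℕ}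
    {a : ℕ → ℝ} (ha : ∀ k, a (k + v + 1) = p * a (k + v) + (1 - p) * a k) :
    ∃ C, ∀ k, |a k - (a v + (1 - p) * ∑ i ∈ Finset.range v, a i) / (1 + (1 - p) * v)| ≤
      C * (1 + p / ((v + 1 : ℕ) : ℝ) ^ 3)⁻¹ ^ k := by
  set L := (a v + (1 - p) * ∑ i ∈ Finset.range v, a i) / (1 + (1 - p) * v) with hL
  have hwindow (k : ℕ) :
      a (k + v) - L + (1 - p) * ∑ i ∈ Finset.range v, (a (k + i) - L) = 0 := by
    rw [eq_div_iff (one_add_mul_natCast_pos hp1 v).ne'] at hL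
    rw [Finset.sum_sub_distrib, Finset.sum_const, Finset.card_range, nsmul_eq_mul]
    linear_combination add_sum_range_eq_of_recurrence ha k - hL
  have hannihilated :
      Polynomial.aeval (seqShift ℂ ℂ) (charPoly p v) (fun k => ((a k - L : ℝ) : ℂ)) = 0 := by
    funext k
    rw [aeval_seqShift_charPoly_apply, Pi.zero_apply]
    exact_mod_cast hwindow k
  obtain ⟨C, hC⟩ := exists_norm_le_of_aeval_seqShift_eq_zero
    (μ := (1 + p / ((v + 1 : ℕ) : ℝ) ^ 3)⁻¹) (by positivity)
    (fun hzero => eval_one_charPoly_ne_zero hp1 v (by rw [hzero, Polynomial.eval_zero]))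
    (IsAlgClosed.splits _) (fun α => norm_root_charPoly_lt hp0 hp1 v) hannihilated
  simp only [Complex.norm_real, Real.norm_eq_abs] at hC
  exact ⟨C, hC⟩

/-- In the recurrence the truncated subtraction makes `N k` equal to `1 + k * q ^ v * (q - 1)`
for `k ≤ v + 1`. -/
lemma exists_abs_sub_le_of_counting_recurrence {q : ℝ} (hq : 2 ≤ q) (v : ℕ) {N : ℕ → ℝ}
    (hN0 : N 0 = 1) (hN : ∀ m, N (m + 1) = N m + q ^ v * (q - 1) * N (m - v)) :
    ∃ C, ∀ k, |N (k - v) * q ^ v / q ^ k - q ^ (v + 1) / ((q - 1) * (v + 1 : ℕ) + 1)| ≤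
      C * (1 + q⁻¹ / ((v + 1 : ℕ) : ℝ) ^ 3)⁻¹ ^ k := by
  have hq0 : 0 < q := by linarith
  have hp1 : q⁻¹ ≤ 1 / 2 := by
    rw [one_div]
    exact inv_anti₀ two_pos hq
  set a : ℕ → ℝ := fun k => N (k - v) * q ^ v / q ^ k with ha
  have hrec (k : ℕ) : a (k + v + 1) = q⁻¹ * a (k + v) + (1 - q⁻¹) * a k := by
    simp only [ha]
    rw [show k + v + 1 - v = k + 1 by lia, Nat.add_sub_cancel, hN]
    field_simp
    ring
  have hav : a v = 1 := by
    simp only [ha, Nat.sub_self, hN0, one_mul]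
    exact div_self (pow_pos hq0 v).ne'
  have hsum : ∑ i ∈ Finset.range v, a i = (∑ i ∈ Finset.range v, q ^ i) * q := by
    rw [← Finset.sum_range_reflect, Finset.sum_mul]
    refine Finset.sum_congr rfl fun i hi => ?_
    have hiv := Finset.mem_range.1 hi
    simp only [ha]
    rw [show v - 1 - i - v = 0 by lia, hN0, one_mul, div_eq_iff (by positivity), ← pow_succ,
      ← pow_add]
    congr 1
    lia
  have hlimit : (a v + (1 - q⁻¹) * ∑ i ∈ Finset.range v, a i) / (1 + (1 - q⁻¹) * v)
      = q ^ (v + 1) / ((q - 1) * (v + 1 : ℕ) + 1) := by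
    have hden : 0 < (q - 1) * (v + 1 : ℕ) + 1 :=
      add_pos_of_nonneg_of_pos (mul_nonneg (by linarith) (Nat.cast_nonneg _)) one_pos
    have hnum : a v + (1 - q⁻¹) * ∑ i ∈ Finset.range v, a i = q ^ v := by
      rw [hav, hsum]
      field_simp
      linear_combination geom_sum_mul q v
    rw [hnum, div_eq_div_iff (one_add_mul_natCast_pos hp1 v).ne' hden.ne']
    push_cast
    field_simp
    ring
  rw [← hlimit]
  exact exists_abs_sub_le_of_recurrence (inv_pos.2 hq0) hp1 hrec

end CountingRecurrence

/-! ### Fractional parts -/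

section FractionalParts

variable {E : Type*} [NormedAddCommGroup E] {Λ : Submodule ℤ E} {T T' : Set E}

lemma fracPart_mem (hT' : IsExactTiling Λ T') (x : E) : fracPart hT' x ∈ T' :=
  (hT' x).choose_spec.1.1

lemma sub_fracPart_mem (hT' : IsExactTiling Λ T') (x : E) : x - fracPart hT' x ∈ Λ :=
  (hT' x).choose_spec.1.2

lemma fracPart_eq (hT' : IsExactTiling Λ T') {x v : E} (hv : v ∈ T') (hxv : x - v ∈ Λ) :
    fracPart hT' x = v :=
  ((hT' x).choose_spec.2 v ⟨hv, hxv⟩).symm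

lemma fracPart_eq_fracPart_of_sub_mem (hT' : IsExactTiling Λ T') {x y : E} (hxy : x - y ∈ Λ) :
    fracPart hT' x = fracPart hT' y :=
  fracPart_eq hT' (fracPart_mem hT' y)
    (sub_add_sub_cancel x y (fracPart hT' y) ▸ Λ.add_mem hxy (sub_fracPart_mem hT' y))

lemma image_fracPart_subset (hT' : IsExactTiling Λ T') (B : Set E) :
    fracPart hT' '' B ⊆ T' :=
  image_subset_iff.2 fun x _ => fracPart_mem hT' x

lemma image_fracPart_eq_iUnion (hT' : IsExactTiling Λ T') (B : Set E) :
    fracPart hT' '' B = ⋃ g : Λ, (g +ᵥ B) ∩ T' := by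
  ext v
  simp only [mem_image, mem_iUnion, mem_inter_iff, mem_vadd_set, Submodule.vadd_def, vadd_eq_add]
  constructor
  · rintro ⟨x, hx, rfl⟩
    refine ⟨-⟨_, sub_fracPart_mem hT' x⟩, ⟨x, hx, ?_⟩, fracPart_mem hT' x⟩
    rw [Submodule.coe_neg, neg_sub, sub_add_cancel]
  · rintro ⟨g, ⟨x, hx, rfl⟩, hv⟩
    refine ⟨x, hx, fracPart_eq hT' hv ?_⟩
    rw [sub_add_cancel_right]
    exact Λ.neg_mem g.2

variable [MeasurableSpace E] {vol : Measure E}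

lemma interior_subset_of_isExactTiling (hT : IsTiling vol Λ T) (hT'T : T' ⊆ T)
    (hT' : IsExactTiling Λ T') : interior T ⊆ T' := by
  intro x hx
  have hfrac : x - fracPart hT' x = 0 := by
    by_contra hne
    exact (hT.inter_subset _ (sub_fracPart_mem hT' x) hne ⟨interior_subset hx,
      mem_vadd_set.2 ⟨_, hT'T (fracPart_mem hT' x), sub_add_cancel x _⟩⟩).2 hx
  rw [sub_eq_zero.1 hfrac]
  exact fracPart_mem hT' x

variable [BorelSpace E]

lemma nullMeasurableSet_of_isExactTiling (hT : IsTiling vol Λ T) (hT'T : T' ⊆ T)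
    (hT' : IsExactTiling Λ T') : NullMeasurableSet T' vol := by
  have hle : T ≤ᵐ[vol] T' := by
    rw [ae_le_set]
    refine measure_mono_null (fun x hx => ?_) hT.frontier_null
    exact ⟨subset_closure hx.1, fun h => hx.2 (interior_subset_of_isExactTiling hT hT'T hT' h)⟩
  exact hT.isClosed.measurableSet.nullMeasurableSet.congr (hle.antisymm hT'T.eventuallyLE)

lemma isAddFundamentalDomain_of_isExactTiling (hT : IsTiling vol Λ T) (hT'T : T' ⊆ T)
    (hT' : IsExactTiling Λ T') : IsAddFundamentalDomain Λ T' vol := by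
  refine IsAddFundamentalDomain.mk' (nullMeasurableSet_of_isExactTiling hT hT'T hT') fun x => ?_
  simp only [Submodule.vadd_def, vadd_eq_add]
  refine ⟨-⟨_, sub_fracPart_mem hT' x⟩, ?_, fun g hg => Subtype.ext ?_⟩
  · simpa only [Submodule.coe_neg, neg_sub, sub_add_cancel] using fracPart_mem hT' x
  · have hfrac : fracPart hT' x = g + x :=
      fracPart_eq hT' hg (by rw [sub_add_cancel_right]; exact Λ.neg_mem g.2)
    simp only [Submodule.coe_neg, hfrac, sub_add_cancel_right, neg_neg]

variable [Countable Λ]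

lemma nullMeasurableSet_image_fracPart (hT : IsTiling vol Λ T) (hT'T : T' ⊆ T)
    (hT' : IsExactTiling Λ T') {B : Set E} (hB : MeasurableSet B) :
    NullMeasurableSet (fracPart hT' '' B) vol := by
  rw [image_fracPart_eq_iUnion]
  exact NullMeasurableSet.iUnion fun g => (hB.const_vadd (g : E)).nullMeasurableSet.inter
    (nullMeasurableSet_of_isExactTiling hT hT'T hT')

lemma measure_image_fracPart [vol.IsAddLeftInvariant] (hT : IsTiling vol Λ T) (hT'T : T' ⊆ T)
    (hT' : IsExactTiling Λ T') {B : Set E} (hB : MeasurableSet B) (hinj : InjOn (fracPart hT') B) :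
    vol (fracPart hT' '' B) = vol B := by
  have : VAddInvariantMeasure Λ E vol := ⟨fun g s _ => measure_preimage_add vol (g : E) s⟩
  rw [image_fracPart_eq_iUnion, measure_iUnion₀,
    (isAddFundamentalDomain_of_isExactTiling hT hT'T hT').measure_eq_tsum B]
  · intro g g' hne
    refine Disjoint.aedisjoint (Disjoint.mono inter_subset_left inter_subset_left ?_)
    refine Set.disjoint_left.2 ?_
    rintro _ ⟨x, hx, rfl⟩ ⟨x', hx', heq : (g' : E) + x' = g + x⟩
    refine hne (Subtype.ext ?_)
    have hsub : x' - x = g - g' := by rw [sub_eq_sub_iff_add_eq_add, add_comm, heq]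
    rw [hinj hx' hx (fracPart_eq_fracPart_of_sub_mem hT' (hsub ▸ Λ.sub_mem g.2 g'.2)), sub_self]
      at hsub
    exact sub_eq_zero.1 hsub.symm
  · exact fun g => (hB.const_vadd (g : E)).nullMeasurableSet.inter
      (nullMeasurableSet_of_isExactTiling hT hT'T hT')

end FractionalParts

lemma DigitSystem.injOn_fracPart {E : Type*} [NormedAddCommGroup E] [NormedSpace ℝ E]
    {Λ : Submodule ℤ E} {Φ : E ≃L[ℝ] E} {ρ : ℝ} {T T' : Set E} {r R : ℝ} {w : ℕ} {D : Set E}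
    (h : DigitSystem Λ Φ ρ T r R w D) (hT' : IsExactTiling Λ T') {B : Set E} {c : E}
    (hB : ∀ x ∈ B, ‖x - c‖ ≤ R / (ρ ^ w - 1)) : InjOn (fracPart hT') B := by
  intro x hx y hy hxy
  have hmem : x - y ∈ Λ := by
    have := Λ.sub_mem (sub_fracPart_mem hT' x) (sub_fracPart_mem hT' y)
    rwa [hxy, sub_sub_sub_cancel_right] at this
  refine sub_eq_zero.1 (h.eq_zero_of_norm_tile_sub_lt (h.mem_tile_of_norm_le (hB x hx)) hmem ?_)
  rw [sub_sub_sub_cancel_left]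
  exact (hB y hy).trans_lt h.div_pow_sub_one_lt

/-! ### Measures of the approximations -/

section Tilings

variable {E : Type*} [NormedAddCommGroup E] [MeasurableSpace E] {vol : Measure E}
  [vol.IsAddLeftInvariant] {Λ : Submodule ℤ E} {T : Set E}

lemma measureReal_vadd (x : E) (s : Set E) : vol.real (x +ᵥ s) = vol.real s :=
  congrArg ENNReal.toReal (measure_vadd vol x s)

lemma aedisjoint_vadd_tile (hT : IsTiling vol Λ T) {z z' : E} (hz : z ∈ Λ) (hz' : z' ∈ Λ)
    (hne : z ≠ z') : AEDisjoint vol (z +ᵥ T) (z' +ᵥ T) := by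
  have hinter : (z +ᵥ T) ∩ (z' +ᵥ T) = z +ᵥ (T ∩ ((z' - z) +ᵥ T)) := by
    rw [vadd_set_inter, vadd_vadd, add_sub_cancel]
  rw [AEDisjoint, hinter, measure_vadd]
  exact measure_mono_null (hT.inter_subset _ (Λ.sub_mem hz' hz) (sub_ne_zero.2 hne.symm))
    hT.frontier_null

lemma measureReal_iUnion_vadd_tile [BorelSpace E] (hT : IsTiling vol Λ T) (hvolT : vol T ≠ ∞)
    {S : Set E} (hS : S.Finite) (hSΛ : S ⊆ Λ) :
    vol.real (⋃ z ∈ S, (z +ᵥ T)) = S.ncard * vol.real T := by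
  lift S to Finset E using hS
  simp only [Finset.mem_coe]
  rw [measureReal_biUnion_finset₀ ?_ ?_ fun z _ => by rwa [measure_vadd]]
  · simp only [measureReal_vadd, Finset.sum_const, nsmul_eq_mul, ncard_coe_finset]
  · exact fun z hz z' hz' hne => aedisjoint_vadd_tile hT (hSΛ hz) (hSΛ hz') hne
  · exact fun z _ => (hT.isClosed.vadd z).measurableSet.nullMeasurableSet

end Tilings

section Similarities

variable {E : Type*} [NormedAddCommGroup E] [NormedSpace ℝ E] {Φ : E ≃L[ℝ] E} {ρ : ℝ}

lemma image_closedBall_one_of_norm_map (hρ : 0 < ρ) (hΦ : ∀ x, ‖Φ x‖ = ρ * ‖x‖) :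
    Φ '' Metric.closedBall 0 1 = Metric.closedBall 0 ρ := by
  ext y
  obtain ⟨x, rfl⟩ := Φ.surjective y
  rw [Φ.injective.mem_set_image, mem_closedBall_zero_iff, mem_closedBall_zero_iff, hΦ,
    mul_le_iff_le_one_right hρ]

lemma measure_image_of_norm_map [FiniteDimensional ℝ E] [MeasurableSpace E] [BorelSpace E]
    {vol : Measure E} [vol.IsAddHaarMeasure] (hρ : 0 < ρ) (hΦ : ∀ x, ‖Φ x‖ = ρ * ‖x‖) (s : Set E) :
    vol (Φ '' s) = ENNReal.ofReal (ρ ^ Module.finrank ℝ E) * vol s := by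
  have hball := Measure.addHaar_image_continuousLinearEquiv vol Φ (Metric.closedBall 0 1)
  rw [image_closedBall_one_of_norm_map hρ hΦ, Measure.addHaar_closedBall' vol 0 hρ.le,
    ENNReal.mul_left_inj (Metric.measure_closedBall_pos vol 0 one_pos).ne'
      measure_closedBall_lt_top.ne] at hball
  rw [Measure.addHaar_image_continuousLinearEquiv, hball]

end Similarities

section MeasuredDigitSystems

variable {E : Type*} [NormedAddCommGroup E] [NormedSpace ℝ E] [MeasurableSpace E]
  {vol : Measure E} {Λ : Submodule ℤ E} {Φ : E ≃L[ℝ] E} {ρ : ℝ} {n : ℕ} {T : Set E} {r R : ℝ}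
  {w : ℕ} {D : Set E}

/-- A digit system in dimension `n` whose tile is closed with boundary of measure zero, and whose
digit set has the number of elements it has for integral `ρ ^ n = |det Φ|`. -/
structure MeasuredDigitSystem (vol : Measure E) (Λ : Submodule ℤ E) (Φ : E ≃L[ℝ] E) (ρ : ℝ)
    (n : ℕ) (T : Set E) (r R : ℝ) (w : ℕ) (D : Set E) : Prop
    extends DigitSystem Λ Φ ρ T r R w D, IsTiling vol Λ T where
  finrank_eq : Module.finrank ℝ E = n
  two_le_pow : 2 ≤ ρ ^ n
  ncard_digits : (D.ncard : ℝ) = ρ ^ (n * (w - 1)) * (ρ ^ n - 1) + 1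

namespace MeasuredDigitSystem

lemma pow_pos (h : MeasuredDigitSystem vol Λ Φ ρ n T r R w D) : 0 < ρ ^ n :=
  zero_lt_two.trans_le h.two_le_pow

lemma ncard_nonzero_digits (h : MeasuredDigitSystem vol Λ Φ ρ n T r R w D) :
    ((D \ {0}).ncard : ℝ) = (ρ ^ n) ^ (w - 1) * (ρ ^ n - 1) := by
  rw [ncard_sdiff_singleton_of_mem h.digits.zero_mem,
    Nat.cast_sub ((ncard_pos h.finite).2 ⟨0, h.digits.zero_mem⟩), h.ncard_digits, Nat.cast_one,
    add_sub_cancel_right, pow_mul]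

variable [FiniteDimensional ℝ E]

lemma isClosed_charApprox (h : MeasuredDigitSystem vol Λ Φ ρ n T r R w D) {η : E} (hη : η ∈ D)
    (hη0 : η ≠ 0) (j : ℕ) : IsClosed (charApprox Λ T Φ D w η j) := by
  rw [h.charApprox_eq_image_iUnion hη hη0]
  exact (Φ ^ (-((j : ℤ) + w))).toHomeomorph.isClosedMap _ <|
    ((h.finite_intValues _).image _).isClosed_biUnion fun z _ => h.isClosed.vadd z

section Haar

variable [vol.IsAddHaarMeasure]

lemma measure_tile_ne_top (h : MeasuredDigitSystem vol Λ Φ ρ n T r R w D) : vol T ≠ ∞ :=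
  measure_ne_top_of_subset h.subset_closedBall measure_closedBall_lt_top.ne

variable [BorelSpace E]

lemma measure_image_zpow (h : MeasuredDigitSystem vol Λ Φ ρ n T r R w D) (k : ℤ) (s : Set E) :
    vol ((Φ ^ k) '' s) = ENNReal.ofReal ((ρ ^ n) ^ k) * vol s := by
  rw [measure_image_of_norm_map (zpow_pos h.ratio_pos k) (h.norm_zpow k), h.finrank_eq,
    ← zpow_natCast, ← zpow_natCast, zpow_comm]

lemma measureReal_image_zpow (h : MeasuredDigitSystem vol Λ Φ ρ n T r R w D) (k : ℤ)
    (s : Set E) : vol.real ((Φ ^ k) '' s) = (ρ ^ n) ^ k * vol.real s := by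
  rw [measureReal_def, h.measure_image_zpow, ENNReal.toReal_mul,
    ENNReal.toReal_ofReal (zpow_nonneg h.pow_pos.le k), measureReal_def]

lemma measureReal_charApprox (h : MeasuredDigitSystem vol Λ Φ ρ n T r R w D) {η : E}
    (hη : η ∈ D) (hη0 : η ≠ 0) (j : ℕ) :
    vol.real (charApprox Λ T Φ D w η j)
      = (intValues Φ D w (j + 1 - w)).ncard / (ρ ^ n) ^ (j + w) * vol.real T := by
  have hsub : (Φ ^ j) η +ᵥ intValues Φ D w (j + 1 - w) ⊆ (Λ : Set E) := by
    rintro _ ⟨y, hy, rfl⟩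
    exact Λ.add_mem (h.pow_mem j (h.digits.subset hη)) (h.intValues_subset _ hy)
  rw [h.charApprox_eq_image_iUnion hη hη0, h.measureReal_image_zpow,
    measureReal_iUnion_vadd_tile h.toIsTiling h.measure_tile_ne_top
      ((h.finite_intValues _).vadd_set) hsub, ncard_vadd_set, zpow_neg, ← Nat.cast_add,
    zpow_natCast]
  ring

end Haar

end MeasuredDigitSystem

end MeasuredDigitSystems

/-! ### Boundaries of self-similar sets -/

section SelfSimilarSets

open scoped NNReal

lemma ae_le_of_subset_iUnion_of_tsum_le {X ι : Type*} [MeasurableSpace X] {μ : Measure X}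
    [Countable ι] {s : Set X} {t : ι → Set X} (hs : NullMeasurableSet s μ) (hsμ : μ s ≠ ∞)
    (hst : s ⊆ ⋃ i, t i) (hsum : ∑' i, μ (t i) ≤ μ s) (i : ι) : t i ≤ᵐ[μ] s := by
  have hsplit : ∑' i, μ (t i ∩ s) + ∑' i, μ (t i \ s) ≤ μ s := by
    rw [← ENNReal.tsum_add]
    simpa only [measure_inter_add_sdiff₀ _ hs] using hsum
  have hcover : μ s ≤ ∑' i, μ (t i ∩ s) := by
    refine (measure_mono ?_).trans (measure_iUnion_le _)
    rw [← iUnion_inter]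
    exact subset_inter hst Subset.rfl
  have hnull : ∑' i, μ (t i \ s) = 0 := by
    refine nonpos_iff_eq_zero.1 ((ENNReal.add_le_add_iff_left hsμ).1 ?_)
    rw [add_zero]
    exact (add_le_add_left hcover _).trans hsplit
  exact ae_le_set.2 (ENNReal.tsum_eq_zero.1 hnull i)

variable {X ι : Type*} {F : Set X}

lemma frontier_iUnion_subset_of_finite [TopologicalSpace X] [Finite ι] (t : ι → Set X) :
    frontier (⋃ i, t i) ⊆ ⋃ i, frontier (t i) := by
  intro x ⟨hx, hx'⟩
  rw [closure_iUnion_of_finite] at hx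
  obtain ⟨i, hi⟩ := mem_iUnion.1 hx
  exact mem_iUnion.2 ⟨i, hi, fun hxint => hx' (interior_mono (subset_iUnion t i) hxint)⟩

lemma ae_le_frontier_of_eq_iUnion_image [TopologicalSpace X] [MeasurableSpace X]
    [OpensMeasurableSpace X] {μ : Measure X} [Finite ι] {f : ι → X ≃ₜ X} {c : ι → ℝ≥0∞}
    (hF : F = ⋃ i, f i '' F) (hFμ : μ (frontier F) ≠ ∞)
    (hf : ∀ i s, μ (f i '' s) = c i * μ s) (hc : ∑' i, c i = 1) (i : ι) :
    f i '' frontier F ≤ᵐ[μ] frontier F := by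
  refine ae_le_of_subset_iUnion_of_tsum_le (t := fun i => f i '' frontier F)
    isClosed_frontier.measurableSet.nullMeasurableSet hFμ ?_ ?_ i
  · conv_lhs => rw [hF]
    simpa only [Homeomorph.image_frontier] using
      frontier_iUnion_subset_of_finite fun i => f i '' F
  · simp only [hf, ENNReal.tsum_mul_right, hc, one_mul, le_refl]

variable [PseudoMetricSpace X] [MeasurableSpace X] [OpensMeasurableSpace X] {μ : Measure X}
  [Finite ι] {f : ι → X ≃ₜ X} {c : ι → ℝ≥0∞} {K : ℝ≥0}

lemma exists_lipschitzWith_pow_ae_le_frontier (hK : ∀ i, LipschitzWith K (f i))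
    (hF : F = ⋃ i, f i '' F) (hFμ : μ (frontier F) ≠ ∞)
    (hf : ∀ i s, μ (f i '' s) = c i * μ s) (hc : ∑' i, c i = 1) (hc0 : ∀ i, c i ≠ 0)
    (m : ℕ) {x : X} (hx : x ∈ F) :
    ∃ g : X → X, LipschitzWith (K ^ m) g ∧ x ∈ g '' F ∧ g '' frontier F ≤ᵐ[μ] frontier F ∧
      ∀ s, μ (g '' s) = 0 → μ s = 0 := by
  induction m generalizing x with
  | zero =>
    exact ⟨id, by simpa using LipschitzWith.id, by simpa using hx,
      (image_id (frontier F)).subset.eventuallyLE, by simp⟩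
  | succ m ih =>
    rw [hF] at hx
    obtain ⟨i, y, hy, rfl⟩ := mem_iUnion.1 hx
    obtain ⟨g, hgK, hyg, hgF, hg⟩ := ih hy
    refine ⟨f i ∘ g, pow_succ' K m ▸ (hK i).comp hgK, ?_, ?_, fun s hs => ?_⟩
    · rw [image_comp]
      exact mem_image_of_mem _ hyg
    · rw [image_comp]
      refine EventuallyLE.trans ?_ (ae_le_frontier_of_eq_iUnion_image hF hFμ hf hc i)
      rw [ae_le_set, ← Set.image_sdiff (f i).injective, hf, ae_le_set.1 hgF, mul_zero]
    · rw [image_comp, hf, mul_eq_zero] at hs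
      exact hg s (hs.resolve_left (hc0 i))

/- The boundaries of the pieces `f i '' F` cover `frontier F` and have the same total measure, so
they lie in `frontier F` almost everywhere; but small pieces fit into the interior of `F`. -/
lemma measure_frontier_eq_zero_of_eq_iUnion_image (hF : F = ⋃ i, f i '' F) (hFc : IsClosed F)
    (hFb : Bornology.IsBounded F) (hFint : (interior F).Nonempty) (hFμ : μ (frontier F) ≠ ∞)
    (hK : ∀ i, LipschitzWith K (f i))
    (hK1 : K < 1) (hf : ∀ i s, μ (f i '' s) = c i * μ s) (hc : ∑' i, c i = 1)
    (hc0 : ∀ i, c i ≠ 0) : μ (frontier F) = 0 := by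
  obtain ⟨x, hx⟩ := hFint
  obtain ⟨ε, hε, hball⟩ := Metric.isOpen_iff.1 isOpen_interior x hx
  obtain ⟨m, hm⟩ : ∃ m : ℕ, (K : ℝ) ^ m * Metric.diam F < ε := by
    refine (Tendsto.eventually_lt_const hε ?_).exists (f := atTop)
    simpa using (tendsto_pow_atTop_nhds_zero_of_lt_one K.2 hK1).mul_const (Metric.diam F)
  obtain ⟨g, hgK, ⟨y, hy, rfl⟩, hgF, hg⟩ :=
    exists_lipschitzWith_pow_ae_le_frontier hK hF hFμ hf hc hc0 m (interior_subset hx)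
  have hsmall : g '' F ⊆ interior F := by
    rintro _ ⟨z, hz, rfl⟩
    refine hball (lt_of_le_of_lt ((hgK.dist_le_mul z y).trans ?_) hm)
    rw [NNReal.coe_pow]
    exact mul_le_mul_of_nonneg_left (Metric.dist_le_diam_of_mem hFb hz hy) (by positivity)
  have hdisjoint : Disjoint (g '' frontier F) (frontier F) :=
    disjoint_interior_frontier.mono_left ((image_mono hFc.frontier_subset).trans hsmall)
  refine hg _ ?_
  rwa [ae_le_set, hdisjoint.sdiff_eq_left] at hgF

end SelfSimilarSets

/-! ### The boundary of a characteristic set -/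

section Covering

variable {E : Type*} [NormedAddCommGroup E] [NormedSpace ℝ E] {Λ : Submodule ℤ E} {Φ : E ≃L[ℝ] E}
  {ρ : ℝ} {T : Set E} {r R : ℝ} {w : ℕ} {D : Set E}

/-- The similarities of the self-similar fundamental domain, indexed by the digit at position `-1`:
the digit zero (`none`) leaves the remaining digits free, a non-zero digit forces the next `w - 1`
digits to vanish. -/
noncomputable def digitMap (Φ : E ≃L[ℝ] E) (w : ℕ) {D : Set E} : Option ↥(D \ {0}) → E ≃ₜ E
  | none => (Φ ^ (-1 : ℤ)).toHomeomorph
  | some d => (Φ ^ (-(w : ℤ))).toHomeomorph.trans (Homeomorph.addLeft ((Φ ^ (-1 : ℤ)) d))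

lemma image_digitMap_some (d : ↥(D \ {0})) (s : Set E) :
    digitMap Φ w (some d) '' s = (Φ ^ (-1 : ℤ)) d +ᵥ (Φ ^ (-(w : ℤ))) '' s :=
  image_comp (fun x => (Φ ^ (-1 : ℤ)) d + x) (Φ ^ (-(w : ℤ))) s

namespace DigitSystem

lemma eventually_zpow_neg_add_mul_lt (h : DigitSystem Λ Φ ρ T r R w D) (k : ℕ) {ε : ℝ}
    (hε : 0 < ε) : ∀ᶠ m : ℕ in atTop, ρ ^ (-((m : ℤ) + k)) * R < ε := by
  have htendsto : Tendsto (fun m : ℕ => (ρ ^ (m + k))⁻¹ * R) atTop (𝓝 (0 * R)) :=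
    ((tendsto_pow_atTop_atTop_of_one_lt h.one_lt).comp
      (tendsto_add_atTop_nat k)).inv_tendsto_atTop.mul_const R
  rw [zero_mul] at htendsto
  filter_upwards [htendsto.eventually_lt_const hε] with m hm
  rwa [zpow_neg, ← Nat.cast_add, zpow_natCast]

lemma dist_zpow_neg_le (h : DigitSystem Λ Φ ρ T r R w D) {m : ℤ} {x z t : E} (ht : t ∈ T)
    (hx : (Φ ^ m) x = z + t) : dist x ((Φ ^ (-m)) z) ≤ ρ ^ (-m) * R := by
  rw [dist_eq_norm, ← zpow_neg_zpow_apply Φ m x, hx, ← map_sub, add_sub_cancel_left, h.norm_zpow]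
  exact mul_le_mul_of_nonneg_left (h.norm_le_of_mem_tile ht) (zpow_nonneg h.ratio_pos.le _)

lemma lipschitzWith_digitMap (h : DigitSystem Λ Φ ρ T r R w D) (i : Option ↥(D \ {0})) :
    LipschitzWith (Real.toNNReal ρ⁻¹) (digitMap Φ w i) := by
  refine LipschitzWith.of_dist_le_mul fun x y => ?_
  rw [Real.coe_toNNReal _ (inv_nonneg.2 h.ratio_pos.le)]
  rcases i with _ | d
  · change dist ((Φ ^ (-1 : ℤ)) x) ((Φ ^ (-1 : ℤ)) y) ≤ _
    rw [dist_eq_norm, ← map_sub, h.norm_zpow, zpow_neg_one, dist_eq_norm]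
  · change dist ((Φ ^ (-1 : ℤ)) d + (Φ ^ (-(w : ℤ))) x) ((Φ ^ (-1 : ℤ)) d + (Φ ^ (-(w : ℤ))) y) ≤ _
    rw [dist_add_left, dist_eq_norm, ← map_sub, h.norm_zpow, ← zpow_neg_one, dist_eq_norm]
    refine mul_le_mul_of_nonneg_right (zpow_le_zpow_right₀ h.one_lt.le ?_) (norm_nonneg _)
    have := h.width_pos
    lia

variable [CompleteSpace E]

lemma exists_eq_pow_add_intValue (h : DigitSystem Λ Φ ρ T r R w D) (m : ℕ) {z : E} (hz : z ∈ Λ) :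
    ∃ u ∈ Λ, ∃ v ∈ intValues Φ D w m, z = (Φ ^ m) u + v := by
  have hw := h.width_pos
  induction m using Nat.strong_induction_on generalizing z with
  | _ m ih =>
    rcases m with _ | m
    · exact ⟨z, hz, 0, by rw [h.intValues_zero, mem_singleton_iff], (add_zero z).symm⟩
    rw [h.intValues_succ_eq_union_lowest]
    by_cases hzΦ : z ∈ Φ '' (Λ : Set E)
    · obtain ⟨y, hy, rfl⟩ := hzΦ
      obtain ⟨u, hu, v, hv, rfl⟩ := ih m m.lt_succ_self hy
      exact ⟨u, hu, Φ v, .inl (mem_image_of_mem Φ hv), by rw [map_add, pow_succ']; rfl⟩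
    · obtain ⟨d, ⟨hd, y, hy, hyd⟩, -⟩ := h.digits.existsUnique z hz hzΦ
      have hd0 : d ≠ 0 := by
        rintro rfl
        exact hzΦ (sub_zero z ▸ hyd ▸ h.map_pow_width_mem_image hy)
      obtain ⟨u, hu, v, hv, rfl⟩ := ih (m + 1 - w) (by lia) hy
      refine ⟨(Φ ^ (w - (m + 1))) u, h.pow_mem _ hu, d + (Φ ^ w) v,
        .inr (mem_iUnion₂.2 ⟨d, ⟨hd, hd0⟩, vadd_mem_vadd_set (mem_image_of_mem _ hv)⟩), ?_⟩
      have hpow : (Φ ^ w) ((Φ ^ (m + 1 - w)) u) = (Φ ^ (m + 1)) ((Φ ^ (w - (m + 1))) u) := by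
        change (Φ ^ w * Φ ^ (m + 1 - w)) u = (Φ ^ (m + 1) * Φ ^ (w - (m + 1))) u
        rw [← pow_add, ← pow_add]
        congr 2
        lia
      rw [← hpow, add_left_comm, ← map_add, hyd, add_sub_cancel]

lemma lattice_add_valueSet (h : DigitSystem Λ Φ ρ T r R w D) [DiscreteTopology Λ] :
    (Λ : Set E) + valueSet Φ D w (Iio 0) = univ := by
  have hclosed : IsClosed ((Λ : Set E) + valueSet Φ D w (Iio 0)) :=
    IsClosed.add_right_of_isCompact (AddSubgroup.isClosed_of_discrete (H := Λ.toAddSubgroup))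
      (h.isCompact_valueSet bddAbove_Iio)
  refine eq_univ_of_forall fun x => hclosed.closure_eq ▸ Metric.mem_closure_iff.2 fun ε hε => ?_
  obtain ⟨m, hm⟩ := (h.eventually_zpow_neg_add_mul_lt 0 hε).exists
  rw [Nat.cast_zero, add_zero] at hm
  obtain ⟨z, hz, t, ht, hzt⟩ := mem_iUnion₂.1 (h.iUnion_eq ▸ mem_univ ((Φ ^ (m : ℤ)) x))
  refine ⟨(Φ ^ (-(m : ℤ))) z, ?_, (h.dist_zpow_neg_le ht hzt.symm).trans_lt hm⟩
  obtain ⟨u, hu, v, hv, rfl⟩ := h.exists_eq_pow_add_intValue m hz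
  rw [map_add, ← zpow_natCast, zpow_neg_zpow_apply]
  refine add_mem_add hu (valueSet_mono Ico_subset_Iio_self (?_ : _ ∈ valueSet Φ D w (Ico (-m) 0)))
  rw [← image_zpow_intValues, zero_sub, neg_neg, Int.toNat_natCast]
  exact mem_image_of_mem _ hv

lemma interior_valueSet_nonempty (h : DigitSystem Λ Φ ρ T r R w D) [DiscreteTopology Λ]
    [Countable Λ] : (interior (valueSet Φ D w (Iio 0))).Nonempty := by
  obtain ⟨z, hz⟩ := nonempty_interior_of_iUnion_of_closed
    (f := fun z : Λ => (z : E) +ᵥ valueSet Φ D w (Iio 0))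
    (fun z => (h.isCompact_valueSet bddAbove_Iio).isClosed.vadd _)
    (by rw [← h.lattice_add_valueSet]; exact (iUnion_subtype _ _).trans (iUnion_vadd_set _ _))
  rw [interior_vadd] at hz
  exact vadd_set_nonempty.1 hz

lemma valueSet_eq_iUnion_image (h : DigitSystem Λ Φ ρ T r R w D) :
    valueSet Φ D w (Iio 0) =
      ⋃ i : Option ↥(D \ {0}), digitMap Φ w i '' valueSet Φ D w (Iio 0) := by
  have hw := h.width_pos
  have hzero : ⇑(Φ ^ (-1 : ℤ)) '' valueSet Φ D w (Iio 0) = valueSet Φ D w (Iio 0 \ {-1}) :=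
    image_zpow_valueSet Φ fun i => by simp only [Set.mem_sdiff, mem_singleton_iff, mem_Iio]; lia
  have hnonzero : ⇑(Φ ^ (-(w : ℤ))) '' valueSet Φ D w (Iio 0)
      = valueSet Φ D w (Iio 0 \ Ioo (-1 - (w : ℤ)) (-1 + w)) :=
    image_zpow_valueSet Φ fun i => by simp only [Set.mem_sdiff, mem_Iio, mem_Ioo]; lia
  conv_lhs => rw [h.valueSet_eq_union_digit bddAbove_Iio (i := -1) (by simp), ← hzero, ← hnonzero]
  simp only [iUnion_option, biUnion_eq_iUnion, image_digitMap_some]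
  rfl

end DigitSystem

end Covering

section NullBoundary

variable {E : Type*} [NormedAddCommGroup E] [NormedSpace ℝ E] [MeasurableSpace E]
  {vol : Measure E} {Λ : Submodule ℤ E} {Φ : E ≃L[ℝ] E} {ρ : ℝ} {n : ℕ} {T : Set E} {r R : ℝ}
  {w : ℕ} {D : Set E}

/-- The factor by which `digitMap Φ w i` scales volumes if `Φ` scales them by `q`. -/
noncomputable def digitRatio (q : ℝ) (w : ℕ) {D : Set E} : Option ↥(D \ {0}) → ℝ≥0∞
  | none => ENNReal.ofReal (q ^ (-1 : ℤ))
  | some _ => ENNReal.ofReal (q ^ (-(w : ℤ)))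

namespace MeasuredDigitSystem

lemma tsum_digitRatio (h : MeasuredDigitSystem vol Λ Φ ρ n T r R w D) :
    ∑' i : Option ↥(D \ {0}), digitRatio (ρ ^ n) w i = 1 := by
  have := (h.finite.sdiff (t := {0})).fintype
  have hq := h.pow_pos
  obtain ⟨v, hv⟩ := Nat.exists_eq_add_of_lt h.width_pos
  have hcard : (Fintype.card ↥(D \ {0}) : ℝ) = (ρ ^ n) ^ (w - 1) * (ρ ^ n - 1) := by
    rw [← h.ncard_nonzero_digits, ← Nat.card_coe_set_eq, Nat.card_eq_fintype_card]
  rw [tsum_fintype, Fintype.sum_option]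
  simp only [digitRatio, Finset.sum_const, Finset.card_univ]
  rw [← ENNReal.ofReal_nsmul, ← ENNReal.ofReal_add (by positivity) (by positivity),
    ENNReal.ofReal_eq_one, nsmul_eq_mul, hcard, hv, zero_add, Nat.add_sub_cancel, zpow_neg_one,
    zpow_neg, zpow_natCast]
  field_simp
  ring

variable [FiniteDimensional ℝ E] [BorelSpace E] [vol.IsAddHaarMeasure]

lemma measure_image_digitMap (h : MeasuredDigitSystem vol Λ Φ ρ n T r R w D)
    (i : Option ↥(D \ {0})) (s : Set E) :
    vol (digitMap Φ w i '' s) = digitRatio (ρ ^ n) w i * vol s := by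
  rcases i with _ | d
  · exact h.measure_image_zpow _ s
  · rw [image_digitMap_some, measure_vadd]
    exact h.measure_image_zpow _ s

lemma measure_frontier_valueSet (h : MeasuredDigitSystem vol Λ Φ ρ n T r R w D)
    [DiscreteTopology Λ] : vol (frontier (valueSet Φ D w (Iio 0))) = 0 := by
  have : Finite ↥(D \ {0}) := (h.finite.sdiff (t := {0})).to_subtype
  have : Countable Λ := countable_of_Lindelof_of_discrete
  have hcompact := h.isCompact_valueSet (I := Iio 0) bddAbove_Iio
  refine measure_frontier_eq_zero_of_eq_iUnion_image h.valueSet_eq_iUnion_image hcompact.isClosed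
    hcompact.isBounded h.interior_valueSet_nonempty
    (measure_ne_top_of_subset hcompact.isClosed.frontier_subset hcompact.measure_lt_top.ne)
    h.lipschitzWith_digitMap ?_ h.measure_image_digitMap h.tsum_digitRatio ?_
  · exact NNReal.coe_lt_coe.1 (by simpa using inv_lt_one_of_one_lt₀ h.one_lt)
  · rintro (_ | _) <;> exact (ENNReal.ofReal_pos.2 (zpow_pos h.pow_pos _)).ne'

lemma measure_frontier_charSet (h : MeasuredDigitSystem vol Λ Φ ρ n T r R w D)
    [DiscreteTopology Λ] {η : E} (hη : η ∈ D) (hη0 : η ≠ 0) :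
    vol (frontier (charSet Φ D w η)) = 0 := by
  have hfrontier : frontier (charSet Φ D w η) = (Φ ^ (-(w : ℤ))) η +ᵥ
      (Φ ^ (-2 * (w : ℤ) + 1)) '' frontier (valueSet Φ D w (Iio 0)) := by
    rw [h.charSet_eq_vadd_image_fundDomain hη hη0, fundDomain_eq_valueSet]
    rw [← image_vadd, ← image_vadd, ← image_comp, ← image_comp]
    exact (((Φ ^ (-2 * (w : ℤ) + 1)).toHomeomorph.trans
      (Homeomorph.addLeft ((Φ ^ (-(w : ℤ))) η))).image_frontier _).symm
  rw [hfrontier, measure_vadd, h.measure_image_zpow, h.measure_frontier_valueSet, mul_zero]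

end MeasuredDigitSystem

end NullBoundary

/-! ### Topology of the characteristic sets -/

section MonotoneLimits

variable {X ι : Type*} [Preorder ι] [IsDirectedOrder ι] [Nonempty ι] {A : ι → Set X}

lemma liminf_eq_iUnion_of_monotone (hA : Monotone A) : liminf A atTop = ⋃ i, A i := by
  ext x
  rw [mem_liminf_iff_eventually_mem, mem_iUnion, eventually_atTop]
  exact ⟨fun ⟨i, hi⟩ => ⟨i, hi i le_rfl⟩, fun ⟨i, hi⟩ => ⟨i, fun _ hij => hA hij hi⟩⟩

lemma limsup_eq_iUnion_of_monotone (hA : Monotone A) : limsup A atTop = ⋃ i, A i := by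
  ext x
  rw [mem_limsup_iff_frequently_mem, mem_iUnion]
  exact ⟨Frequently.exists, fun ⟨_, hi⟩ =>
    ((eventually_ge_atTop _).mono fun _ hij => hA hij hi).frequently⟩

end MonotoneLimits

section CharacteristicSets

variable {E : Type*} [NormedAddCommGroup E] [NormedSpace ℝ E] [CompleteSpace E]
  {Λ : Submodule ℤ E} {Φ : E ≃L[ℝ] E} {ρ : ℝ} {T : Set E} {r R : ℝ} {w : ℕ} {D : Set E} {η : E}

namespace DigitSystem

lemma isCompact_charSet (h : DigitSystem Λ Φ ρ T r R w D) (hη : η ∈ D) (hη0 : η ≠ 0) :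
    IsCompact (charSet Φ D w η) := by
  rw [h.charSet_eq_vadd_valueSet hη hη0]
  exact (h.isCompact_valueSet bddAbove_Iio).vadd _

lemma monotone_charSetLevel (h : DigitSystem Λ Φ ρ T r R w D) (hη : η ∈ D) (hη0 : η ≠ 0) :
    Monotone (charSetLevel Φ D w η) := by
  intro j j' hj
  simp only [h.charSetLevel_eq_vadd_valueSet hη hη0]
  exact vadd_set_mono (valueSet_mono (Ico_subset_Ico_left (by lia)))

lemma charSetLevel_subset_charSet (h : DigitSystem Λ Φ ρ T r R w D) (hη : η ∈ D) (hη0 : η ≠ 0)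
    (j : ℕ) : charSetLevel Φ D w η j ⊆ charSet Φ D w η := by
  rw [h.charSetLevel_eq_vadd_valueSet hη hη0, h.charSet_eq_vadd_valueSet hη hη0]
  exact vadd_set_mono (valueSet_mono Ico_subset_Iio_self)

lemma charSet_eq_closure_iUnion (h : DigitSystem Λ Φ ρ T r R w D) (hη : η ∈ D) (hη0 : η ≠ 0) :
    charSet Φ D w η = closure (⋃ j : ℕ, charSetLevel Φ D w η j) := by
  refine Subset.antisymm ?_ (closure_minimal
    (iUnion_subset (h.charSetLevel_subset_charSet hη hη0)) (h.isCompact_charSet hη hη0).isClosed)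
  have hlevel (j : ℕ) : (Φ ^ (-(w : ℤ))) η +ᵥ
      valueSet Φ D w (Iio (-2 * (w : ℤ) + 1) ∩ Ici (-(j : ℤ))) ⊆ charSetLevel Φ D w η j := by
    rw [h.charSetLevel_eq_vadd_valueSet hη hη0, inter_comm, Ici_inter_Iio]
    exact vadd_set_mono (valueSet_mono (Ico_subset_Ico_left (by lia)))
  calc charSet Φ D w η
      ⊆ (Φ ^ (-(w : ℤ))) η +ᵥ
          closure (⋃ j : ℕ, valueSet Φ D w (Iio (-2 * (w : ℤ) + 1) ∩ Ici (-(j : ℤ)))) := by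
        rw [h.charSet_eq_vadd_valueSet hη hη0]
        exact vadd_set_mono (valueSet_subset_closure_iUnion h.one_lt h.norm_map h.finite
          h.digits.zero_mem bddAbove_Iio)
    _ ⊆ closure (⋃ j : ℕ, charSetLevel Φ D w η j) := by
        rw [← closure_vadd, vadd_set_iUnion]
        exact closure_mono (iUnion_mono hlevel)

lemma liminf_charSetLevel_eq_limsup (h : DigitSystem Λ Φ ρ T r R w D) (hη : η ∈ D) (hη0 : η ≠ 0) :
    liminf (charSetLevel Φ D w η) atTop = limsup (charSetLevel Φ D w η) atTop :=
  (liminf_eq_iUnion_of_monotone (h.monotone_charSetLevel hη hη0)).trans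
    (limsup_eq_iUnion_of_monotone (h.monotone_charSetLevel hη hη0)).symm

lemma charSet_eq_closure_limsup_charSetLevel (h : DigitSystem Λ Φ ρ T r R w D) (hη : η ∈ D)
    (hη0 : η ≠ 0) : charSet Φ D w η = closure (limsup (charSetLevel Φ D w η) atTop) := by
  rw [limsup_eq_iUnion_of_monotone (h.monotone_charSetLevel hη hη0),
    ← h.charSet_eq_closure_iUnion hη hη0]

lemma mem_vadd_intValues_of_mem_charSet (h : DigitSystem Λ Φ ρ T r R w D) (hη : η ∈ D)
    (hη0 : η ≠ 0) {j : ℕ} {z : E} (hz : z ∈ Λ)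
    (hzη : (Φ ^ (-((j : ℤ) + w))) z ∈ charSet Φ D w η) :
    z ∈ (Φ ^ j) η +ᵥ intValues Φ D w (j + 1 - w) := by
  rw [h.charSet_eq_vadd_valueSet hη hη0] at hzη
  obtain ⟨y, hy, hyz : (Φ ^ (-(w : ℤ))) η + y = (Φ ^ (-((j : ℤ) + w))) z⟩ := hzη
  have hsplit : (Φ ^ j) η + (Φ ^ ((j : ℤ) + w)) y = z := by
    rw [← zpow_zpow_neg_apply Φ ((j : ℤ) + w) z, ← hyz, map_add, ← zpow_add_apply,
      add_neg_cancel_right, zpow_natCast]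
  have htail : (Φ ^ ((j : ℤ) + w)) y ∈ valueSet Φ D w (Iio ((j : ℤ) + 1 - w)) := by
    rw [← image_zpow_valueSet Φ (k := (j : ℤ) + w) (I := Iio (-2 * (w : ℤ) + 1))
      fun i => by simp only [mem_Iio]; lia]
    exact mem_image_of_mem _ hy
  refine ⟨_, h.mem_intValues_of_mem_lattice _
    (valueSet_mono (Iio_subset_Iio (by lia)) htail) ?_, hsplit⟩
  rw [eq_sub_of_add_eq' hsplit]
  exact Λ.sub_mem hz (h.pow_mem j (h.digits.subset hη))

lemma charSetLevel_subset_charApprox (h : DigitSystem Λ Φ ρ T r R w D) (hη : η ∈ D) (hη0 : η ≠ 0)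
    (j : ℕ) : charSetLevel Φ D w η j ⊆ charApprox Λ T Φ D w η j := by
  rw [h.charSetLevel_eq_image_intValues hη hη0, h.charApprox_eq_image_iUnion hη hη0]
  have hzero : (0 : E) ∈ T := h.mem_tile_of_norm_le (norm_zero.trans_le h.div_pow_sub_one_pos.le)
  exact image_mono fun z hz => mem_iUnion₂.2 ⟨z, hz, mem_vadd_set.2 ⟨0, hzero, add_zero z⟩⟩

lemma exists_dist_le_of_mem_charApprox (h : DigitSystem Λ Φ ρ T r R w D) (hη : η ∈ D)
    (hη0 : η ≠ 0) {j : ℕ} {x : E} (hx : x ∈ charApprox Λ T Φ D w η j) :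
    ∃ y ∈ charSet Φ D w η, dist x y ≤ ρ ^ (-((j : ℤ) + w)) * R := by
  rw [h.charApprox_eq_image_iUnion hη hη0] at hx
  obtain ⟨_, hx, rfl⟩ := hx
  obtain ⟨z, hz, t, ht, rfl⟩ := mem_iUnion₂.1 hx
  refine ⟨(Φ ^ (-((j : ℤ) + w))) z, h.charSetLevel_subset_charSet hη hη0 j ?_,
    h.dist_zpow_neg_le ht (zpow_zpow_neg_apply Φ _ _)⟩
  rw [h.charSetLevel_eq_image_intValues hη hη0]
  exact mem_image_of_mem _ hz

lemma limsup_charApprox_subset_charSet (h : DigitSystem Λ Φ ρ T r R w D) (hη : η ∈ D)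
    (hη0 : η ≠ 0) : limsup (charApprox Λ T Φ D w η) atTop ⊆ charSet Φ D w η := by
  intro x hx
  rw [← (h.isCompact_charSet hη hη0).isClosed.closure_eq, Metric.mem_closure_iff]
  intro ε hε
  obtain ⟨j, hj, hjε⟩ := ((mem_limsup_iff_frequently_mem.1 hx).and_eventually
    (h.eventually_zpow_neg_add_mul_lt w hε)).exists
  obtain ⟨y, hy, hxy⟩ := h.exists_dist_le_of_mem_charApprox hη hη0 hj
  exact ⟨y, hy, hxy.trans_lt hjε⟩

lemma charSet_eq_closure_liminf_charApprox (h : DigitSystem Λ Φ ρ T r R w D) (hη : η ∈ D)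
    (hη0 : η ≠ 0) : charSet Φ D w η = closure (liminf (charApprox Λ T Φ D w η) atTop) := by
  refine Subset.antisymm ?_ (closure_minimal
    (Subset.trans liminf_le_limsup (h.limsup_charApprox_subset_charSet hη hη0))
    (h.isCompact_charSet hη hη0).isClosed)
  rw [h.charSet_eq_closure_iUnion hη hη0,
    ← liminf_eq_iUnion_of_monotone (h.monotone_charSetLevel hη hη0)]
  exact closure_mono (liminf_le_liminf
    (Eventually.of_forall (h.charSetLevel_subset_charApprox hη hη0)))

lemma charSet_eq_closure_limsup_charApprox (h : DigitSystem Λ Φ ρ T r R w D) (hη : η ∈ D)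
    (hη0 : η ≠ 0) : charSet Φ D w η = closure (limsup (charApprox Λ T Φ D w η) atTop) := by
  refine Subset.antisymm ?_ (closure_minimal (h.limsup_charApprox_subset_charSet hη hη0)
    (h.isCompact_charSet hη hη0).isClosed)
  rw [h.charSet_eq_closure_liminf_charApprox hη hη0]
  exact closure_mono liminf_le_limsup

lemma interior_charSet_subset_liminf (h : DigitSystem Λ Φ ρ T r R w D) (hη : η ∈ D)
    (hη0 : η ≠ 0) :
    interior (charSet Φ D w η) ⊆ liminf (charApprox Λ T Φ D w η) atTop := by
  intro x hx
  obtain ⟨ε, hε, hball⟩ := Metric.mem_nhds_iff.1 (mem_interior_iff_mem_nhds.1 hx)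
  rw [mem_liminf_iff_eventually_mem]
  filter_upwards [h.eventually_zpow_neg_add_mul_lt w hε] with j hj
  obtain ⟨z, hz, t, ht, hzt⟩ :=
    mem_iUnion₂.1 (h.iUnion_eq ▸ mem_univ ((Φ ^ ((j : ℤ) + w)) x))
  have hzη : (Φ ^ (-((j : ℤ) + w))) z ∈ charSet Φ D w η :=
    hball (Metric.mem_ball'.2 ((h.dist_zpow_neg_le ht hzt.symm).trans_lt hj))
  rw [h.charApprox_eq_image_iUnion hη hη0]
  exact ⟨_, mem_iUnion₂.2 ⟨z, h.mem_vadd_intValues_of_mem_charSet hη hη0 hz hzη, t, ht, hzt⟩,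
    zpow_neg_zpow_apply Φ _ x⟩

end DigitSystem

end CharacteristicSets

/-! ### Volume of the characteristic sets -/

section Volume

lemma decayConst_nonneg {ρ : ℝ} (hρ : 0 ≤ ρ) (n w : ℕ) : 0 ≤ decayConst ρ n w := by
  unfold decayConst
  positivity

lemma decayConst_lt_one {ρ : ℝ} (hρ : 0 < ρ) (n : ℕ) {w : ℕ} (hw : 0 < w) :
    decayConst ρ n w < 1 :=
  inv_lt_one_of_one_lt₀ (lt_add_of_pos_right 1 (by positivity))

lemma integrableOn_indicator_one {X : Type*} [MeasurableSpace X] {μ : Measure X} {S A : Set X}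
    (hS : μ S ≠ ∞) (hA : NullMeasurableSet A μ) :
    IntegrableOn (indicator A fun _ => (1 : ℝ)) S μ :=
  (integrableOn_const hS).indicator₀ (hA.mono_ac Measure.absolutelyContinuous_restrict)

lemma setIntegral_indicator_one {X : Type*} [MeasurableSpace X] {μ : Measure X} {S A : Set X}
    (hA : NullMeasurableSet A μ) (hAS : A ⊆ S) :
    ∫ x in S, indicator A (fun _ => (1 : ℝ)) x ∂μ = μ.real A := by
  have hA' := hA.mono_ac (Measure.absolutelyContinuous_restrict (s := S))
  rw [integral_indicator₀ hA', Measure.restrict_restrict₀ hA', inter_eq_left.2 hAS,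
    setIntegral_const, smul_eq_mul, mul_one]

variable {E : Type*} [NormedAddCommGroup E] [NormedSpace ℝ E] [FiniteDimensional ℝ E]
  [MeasurableSpace E] [BorelSpace E] {vol : Measure E} {Λ : Submodule ℤ E}
  {Φ : E ≃L[ℝ] E} {ρ : ℝ} {n : ℕ} {T T' : Set E} {r R : ℝ} {w : ℕ} {D : Set E} {η : E}

namespace MeasuredDigitSystem

lemma nullMeasurableSet_image_fracPart_charApprox [Countable Λ]
    (h : MeasuredDigitSystem vol Λ Φ ρ n T r R w D) (hT'T : T' ⊆ T) (hT' : IsExactTiling Λ T')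
    (hη : η ∈ D) (hη0 : η ≠ 0) (j : ℕ) :
    NullMeasurableSet (fracPart hT' '' charApprox Λ T Φ D w η j) vol :=
  nullMeasurableSet_image_fracPart h.toIsTiling hT'T hT'
    (h.isClosed_charApprox hη hη0 j).measurableSet

lemma nullMeasurableSet_image_fracPart_charSet [Countable Λ]
    (h : MeasuredDigitSystem vol Λ Φ ρ n T r R w D) (hT'T : T' ⊆ T) (hT' : IsExactTiling Λ T')
    (hη : η ∈ D) (hη0 : η ≠ 0) : NullMeasurableSet (fracPart hT' '' charSet Φ D w η) vol :=
  nullMeasurableSet_image_fracPart h.toIsTiling hT'T hT'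
    (h.isCompact_charSet hη hη0).measurableSet

variable [vol.IsAddHaarMeasure]

lemma exists_abs_measureReal_charApprox_sub_le (h : MeasuredDigitSystem vol Λ Φ ρ n T r R w D)
    (hη : η ∈ D) (hη0 : η ≠ 0) :
    ∃ C : ℝ, ∀ j : ℕ, |vol.real (charApprox Λ T Φ D w η j) - vol.real T * expectConst ρ n w|
      ≤ C * decayConst ρ n w ^ j := by
  obtain ⟨v, rfl⟩ : ∃ v, w = v + 1 := Nat.exists_eq_add_one.2 h.width_pos
  have hq := h.pow_pos
  obtain ⟨C, hC⟩ := exists_abs_sub_le_of_counting_recurrence h.two_le_pow v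
    (N := fun m => ((intValues Φ D (v + 1) m).ncard : ℝ))
    (by rw [h.intValues_zero, ncard_singleton, Nat.cast_one]) fun m => by
      rw [h.ncard_intValues_succ, Nat.cast_add, Nat.cast_mul, h.ncard_nonzero_digits,
        Nat.add_sub_cancel, Nat.add_sub_add_right]
  have hden : 0 < (ρ ^ n - 1) * (v + 1 : ℕ) + 1 :=
    add_pos_of_nonneg_of_pos (mul_nonneg (by linarith [h.two_le_pow]) (Nat.cast_nonneg _)) one_pos
  have hscale (j : ℕ) : vol.real (charApprox Λ T Φ D (v + 1) η j)
      - vol.real T * expectConst ρ n (v + 1)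
      = vol.real T / (ρ ^ n) ^ (2 * v + 1) *
        ((intValues Φ D (v + 1) (j - v)).ncard * (ρ ^ n) ^ v / (ρ ^ n) ^ j
          - (ρ ^ n) ^ (v + 1) / ((ρ ^ n - 1) * (v + 1 : ℕ) + 1)) := by
    rw [h.measureReal_charApprox hη hη0, expectConst, Nat.add_sub_add_right, Nat.add_sub_cancel,
      pow_mul]
    field_simp
    ring
  have hdecay : decayConst ρ n (v + 1) = (1 + (ρ ^ n)⁻¹ / ((v + 1 : ℕ) : ℝ) ^ 3)⁻¹ := by
    rw [decayConst, one_div, mul_inv, div_eq_mul_inv]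
  refine ⟨vol.real T / (ρ ^ n) ^ (2 * v + 1) * C, fun j => ?_⟩
  rw [hscale, hdecay, abs_mul, abs_of_nonneg (by positivity), mul_assoc]
  exact mul_le_mul_of_nonneg_left (hC j) (by positivity)

lemma tendsto_measureReal_charApprox (h : MeasuredDigitSystem vol Λ Φ ρ n T r R w D)
    (hη : η ∈ D) (hη0 : η ≠ 0) :
    Tendsto (fun j => vol.real (charApprox Λ T Φ D w η j)) atTop
      (𝓝 (vol.real T * expectConst ρ n w)) := by
  obtain ⟨C, hC⟩ := h.exists_abs_measureReal_charApprox_sub_le hη hη0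
  refine tendsto_iff_dist_tendsto_zero.2 (squeeze_zero (fun _ => dist_nonneg) hC ?_)
  simpa using (tendsto_pow_atTop_nhds_zero_of_lt_one (decayConst_nonneg h.ratio_pos.le n w)
    (decayConst_lt_one h.ratio_pos n h.width_pos)).const_mul C

lemma measure_image_fracPart_charApprox [Countable Λ]
    (h : MeasuredDigitSystem vol Λ Φ ρ n T r R w D) (hT'T : T' ⊆ T) (hT' : IsExactTiling Λ T')
    (hη : η ∈ D) (hη0 : η ≠ 0) (j : ℕ) :
    vol (fracPart hT' '' charApprox Λ T Φ D w η j) = vol (charApprox Λ T Φ D w η j) :=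
  measure_image_fracPart h.toIsTiling hT'T hT' (h.isClosed_charApprox hη hη0 j).measurableSet
    (h.injOn_fracPart hT' fun _ => h.norm_sub_le_of_mem_charApprox hη hη0)

lemma measure_image_fracPart_charSet [Countable Λ]
    (h : MeasuredDigitSystem vol Λ Φ ρ n T r R w D) (hT'T : T' ⊆ T) (hT' : IsExactTiling Λ T')
    (hη : η ∈ D) (hη0 : η ≠ 0) :
    vol (fracPart hT' '' charSet Φ D w η) = vol (charSet Φ D w η) :=
  measure_image_fracPart h.toIsTiling hT'T hT' (h.isCompact_charSet hη hη0).measurableSet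
    (h.injOn_fracPart hT' fun _ => h.norm_sub_le_of_mem_charSet hη hη0)

lemma integrableOn_indicator_image_fracPart_sub [Countable Λ]
    (h : MeasuredDigitSystem vol Λ Φ ρ n T r R w D) (hT'T : T' ⊆ T) (hT' : IsExactTiling Λ T')
    (hη : η ∈ D) (hη0 : η ≠ 0) (j : ℕ) :
    IntegrableOn (fun x =>
      indicator (fracPart hT' '' charApprox Λ T Φ D w η j) (fun _ => (1 : ℝ)) x
        - indicator (fracPart hT' '' charSet Φ D w η) (fun _ => (1 : ℝ)) x) T vol :=
  (integrableOn_indicator_one h.measure_tile_ne_top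
      (h.nullMeasurableSet_image_fracPart_charApprox hT'T hT' hη hη0 j)).sub
    (integrableOn_indicator_one h.measure_tile_ne_top
      (h.nullMeasurableSet_image_fracPart_charSet hT'T hT' hη hη0))

lemma beta_eq_setIntegral [Countable Λ] (h : MeasuredDigitSystem vol Λ Φ ρ n T r R w D)
    (hT'T : T' ⊆ T) (hT' : IsExactTiling Λ T') (hη : η ∈ D) (hη0 : η ≠ 0) (j : ℕ) :
    beta vol Λ T Φ D w η j =
      ∫ x in T, (indicator (fracPart hT' '' charApprox Λ T Φ D w η j) (fun _ => (1 : ℝ)) x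
        - indicator (fracPart hT' '' charSet Φ D w η) (fun _ => (1 : ℝ)) x) ∂vol := by
  have hnullApprox := h.nullMeasurableSet_image_fracPart_charApprox hT'T hT' hη hη0 j
  have hnullSet := h.nullMeasurableSet_image_fracPart_charSet hT'T hT' hη hη0
  rw [integral_sub (integrableOn_indicator_one h.measure_tile_ne_top hnullApprox)
      (integrableOn_indicator_one h.measure_tile_ne_top hnullSet),
    setIntegral_indicator_one hnullApprox ((image_fracPart_subset hT' _).trans hT'T),
    setIntegral_indicator_one hnullSet ((image_fracPart_subset hT' _).trans hT'T),
    measureReal_def, measureReal_def, h.measure_image_fracPart_charApprox hT'T hT' hη hη0,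
    h.measure_image_fracPart_charSet hT'T hT' hη hη0]
  rfl

variable [DiscreteTopology Λ]

lemma tendsto_measure_charApprox (h : MeasuredDigitSystem vol Λ Φ ρ n T r R w D)
    (hη : η ∈ D) (hη0 : η ≠ 0) :
    Tendsto (fun j => vol (charApprox Λ T Φ D w η j)) atTop (𝓝 (vol (charSet Φ D w η))) := by
  have hclosed := (h.isCompact_charSet hη hη0).isClosed
  refine tendsto_measure_of_ae_tendsto_indicator atTop hclosed.measurableSet
    (fun j => (h.isClosed_charApprox hη hη0 j).measurableSet)
    (Metric.isClosed_closedBall (x := (Φ ^ (-(w : ℤ))) η) (ε := R / (ρ ^ w - 1))).measurableSet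
    measure_closedBall_lt_top.ne (.of_forall fun j x hx => mem_closedBall_iff_norm.2
      (h.norm_sub_le_of_mem_charApprox hη hη0 hx)) ?_
  filter_upwards [measure_eq_zero_iff_ae_notMem.1 (h.measure_frontier_charSet hη hη0)] with x hx
  by_cases hxη : x ∈ charSet Φ D w η
  · have hxint : x ∈ interior (charSet Φ D w η) := by
      by_contra hxint
      exact hx ⟨subset_closure hxη, hxint⟩
    filter_upwards [mem_liminf_iff_eventually_mem.1
      (h.interior_charSet_subset_liminf hη hη0 hxint)] with j hj
    exact iff_of_true hj hxη
  · have hxlimsup : x ∉ limsup (charApprox Λ T Φ D w η) atTop :=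
      fun hx' => hxη (h.limsup_charApprox_subset_charSet hη hη0 hx')
    rw [mem_limsup_iff_frequently_mem, not_frequently] at hxlimsup
    filter_upwards [hxlimsup] with j hj
    exact iff_of_false hj hxη

lemma measureReal_charSet (h : MeasuredDigitSystem vol Λ Φ ρ n T r R w D) (hη : η ∈ D)
    (hη0 : η ≠ 0) : vol.real (charSet Φ D w η) = vol.real T * expectConst ρ n w :=
  tendsto_nhds_unique ((ENNReal.tendsto_toReal
    (h.isCompact_charSet hη hη0).measure_ne_top).comp (h.tendsto_measure_charApprox hη hη0))
    (h.tendsto_measureReal_charApprox hη hη0)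

lemma measure_charSet (h : MeasuredDigitSystem vol Λ Φ ρ n T r R w D) (hη : η ∈ D)
    (hη0 : η ≠ 0) :
    vol (charSet Φ D w η) = vol T * ENNReal.ofReal (expectConst ρ n w) := by
  rw [← ofReal_measureReal (h.isCompact_charSet hη hη0).measure_ne_top,
    h.measureReal_charSet hη hη0, ENNReal.ofReal_mul measureReal_nonneg,
    ofReal_measureReal h.measure_tile_ne_top]

lemma exists_abs_beta_le (h : MeasuredDigitSystem vol Λ Φ ρ n T r R w D) (hη : η ∈ D)
    (hη0 : η ≠ 0) :
    ∃ C : ℝ, ∀ j : ℕ, |beta vol Λ T Φ D w η j| ≤ C * decayConst ρ n w ^ j := by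
  simpa only [beta, h.measureReal_charSet hη hη0] using
    h.exists_abs_measureReal_charApprox_sub_le hη hη0

end MeasuredDigitSystem

end Volume

section Setup

variable {ρ : ℝ} {n : ℕ}

lemma two_le_pow_of_eq_natCast (hρ : 1 < ρ) (hn : n ≠ 0) (hρn : ∃ q : ℕ, ρ ^ n = q) :
    2 ≤ ρ ^ n := by
  obtain ⟨q, hq⟩ := hρn
  have hlt := one_lt_pow₀ hρ hn
  rw [hq] at hlt ⊢
  exact_mod_cast hlt

lemma finite_of_ncard_eq {X : Type*} {D : Set X} {k : ℕ} (hρ : 1 ≤ ρ)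
    (hD : (D.ncard : ℝ) = ρ ^ k * (ρ ^ n - 1) + 1) : D.Finite := by
  refine finite_of_ncard_pos (Nat.cast_pos.1 (?_ : (0 : ℝ) < D.ncard))
  have hpow := sub_nonneg.2 (one_le_pow₀ hρ (n := n))
  rw [hD]
  positivity

end Setup

end WNAF

/-- The space `E` is `ℝⁿ` with the chosen vector norm, `n` its dimension, and `vol` is Lebesgue
measure (in coordinate-free form: a Haar measure). -/
theorem mainTheorem5
    {E : Type*} [NormedAddCommGroup E] [NormedSpace ℝ E] [FiniteDimensional ℝ E]
    [MeasurableSpace E] [BorelSpace E] (vol : Measure E) [vol.IsAddHaarMeasure]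
    (n : ℕ) (hn : 0 < n) (hdim : Module.finrank ℝ E = n)
    -- the lattice
    (Λ : Submodule ℤ E) [DiscreteTopology Λ] [IsZLattice ℝ Λ]
    -- the base
    (Φ : E ≃L[ℝ] E) (hΦΛ : ∀ z ∈ Λ, Φ z ∈ Λ)
    (ρ : ℝ) (hρ : 1 < ρ)
    (hΦeig : ∀ z ∈ (LinearMap.charpoly (Φ : E →ₗ[ℝ] E)).aroots ℂ, ‖z‖ = ρ)
    (hρn : ∃ q : ℕ, ρ ^ n = q)
    (hΦnorm : ‖(Φ : E →L[ℝ] E)‖ = ρ) (hΦinv : ‖(Φ.symm : E →L[ℝ] E)‖ = ρ⁻¹)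
    -- the tiling
    (T : Set E) (hT : WNAF.IsTiling vol Λ T)
    (r R : ℝ) (hr : 0 < r) (hR : 0 < R)
    (hrT : Metric.closedBall 0 r ⊆ T) (hTR : T ⊆ Metric.closedBall 0 R)
    (T' : Set E) (hT'T : T' ⊆ T) (hT' : WNAF.IsExactTiling Λ T')
    -- the width and the digits
    (w : ℕ) (hw : 0 < w) (hrR : R / r < ρ ^ w - 1)
    (D : Set E) (hD : WNAF.IsReducedResidueDigitSet Λ Φ w D) (hDT : D ⊆ (Φ ^ w) '' T)
    (hDcard : (D.ncard : ℝ) = ρ ^ (n * (w - 1)) * (ρ ^ n - 1) + 1)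
    (η : E) (hη : η ∈ D) (hη0 : η ≠ 0) :
    -- description by the fundamental domain
    WNAF.charSet Φ D w η
        = (Φ ^ (-(w : ℤ))) η +ᵥ (Φ ^ (-2 * (w : ℤ) + 1)) '' WNAF.fundDomain Φ D w ∧
    -- compactness
    IsCompact (WNAF.charSet Φ D w η) ∧
    -- closure of the union and of the limit of the finite-level sets
    (WNAF.charSet Φ D w η = closure (⋃ j : ℕ, WNAF.charSetLevel Φ D w η j) ∧
      liminf (fun j : ℕ => WNAF.charSetLevel Φ D w η j) atTop
        = limsup (fun j : ℕ => WNAF.charSetLevel Φ D w η j) atTop ∧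
      WNAF.charSet Φ D w η
        = closure (limsup (fun j : ℕ => WNAF.charSetLevel Φ D w η j) atTop)) ∧
    -- limit of the approximations
    (WNAF.charSet Φ D w η
        = closure (liminf (fun j : ℕ => WNAF.charApprox Λ T Φ D w η j) atTop) ∧
      WNAF.charSet Φ D w η
        = closure (limsup (fun j : ℕ => WNAF.charApprox Λ T Φ D w η j) atTop)) ∧
    -- interior points
    interior (WNAF.charSet Φ D w η)
        ⊆ liminf (fun j : ℕ => WNAF.charApprox Λ T Φ D w η j) atTop ∧
    -- inclusion in the tile
    ((fun x => x - (Φ ^ (-(w : ℤ))) η) '' WNAF.charSet Φ D w η ⊆ T ∧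
      ∀ j : ℕ, (fun x => x - (Φ ^ (-(w : ℤ))) η) '' WNAF.charApprox Λ T Φ D w η j ⊆ T) ∧
    -- measure of the fractional parts
    (NullMeasurableSet (WNAF.fracPart hT' '' WNAF.charSet Φ D w η) vol ∧
      vol (WNAF.charSet Φ D w η) = vol (WNAF.fracPart hT' '' WNAF.charSet Φ D w η) ∧
      ∀ j : ℕ,
        NullMeasurableSet (WNAF.fracPart hT' '' WNAF.charApprox Λ T Φ D w η j) vol ∧
        vol (WNAF.charApprox Λ T Φ D w η j)
          = vol (WNAF.fracPart hT' '' WNAF.charApprox Λ T Φ D w η j)) ∧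
    -- measure of the approximations
    (WNAF.decayConst ρ n w < 1 ∧
      ∃ C : ℝ, ∀ j : ℕ,
        |vol.real (WNAF.charApprox Λ T Φ D w η j) - vol.real T * WNAF.expectConst ρ n w|
          ≤ C * WNAF.decayConst ρ n w ^ j) ∧
    -- measure of the characteristic set
    vol (WNAF.fracPart hT' '' WNAF.charSet Φ D w η)
        = vol T * ENNReal.ofReal (WNAF.expectConst ρ n w) ∧
    -- the differences `beta`
    ((∀ j : ℕ,
        IntegrableOn (fun x =>
          indicator (WNAF.fracPart hT' '' WNAF.charApprox Λ T Φ D w η j) (fun _ => (1 : ℝ)) x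
          - indicator (WNAF.fracPart hT' '' WNAF.charSet Φ D w η) (fun _ => (1 : ℝ)) x) T vol ∧
        WNAF.beta vol Λ T Φ D w η j
          = ∫ x in T,
            (indicator (WNAF.fracPart hT' '' WNAF.charApprox Λ T Φ D w η j)
                (fun _ => (1 : ℝ)) x
              - indicator (WNAF.fracPart hT' '' WNAF.charSet Φ D w η)
                (fun _ => (1 : ℝ)) x) ∂vol) ∧
      ∃ C : ℝ, ∀ j : ℕ, |WNAF.beta vol Λ T Φ D w η j| ≤ C * WNAF.decayConst ρ n w ^ j) := by
  have : Countable Λ := countable_of_Lindelof_of_discrete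
  have h : WNAF.MeasuredDigitSystem vol Λ Φ ρ n T r R w D :=
    { hT with
      one_lt := hρ, width_pos := hw, map_mem := hΦΛ, digits := hD, r_pos := hr, R_pos := hR
      norm_map := WNAF.norm_map_of_norm_eq_of_norm_symm_eq (zero_lt_one.trans hρ) hΦnorm hΦinv
      finite := WNAF.finite_of_ncard_eq hρ.le hDcard
      closedBall_subset := hrT, subset_closedBall := hTR, ratio_lt := hrR, digits_subset := hDT
      finrank_eq := hdim, two_le_pow := WNAF.two_le_pow_of_eq_natCast hρ hn.ne' hρn
      ncard_digits := hDcard }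
  exact ⟨h.charSet_eq_vadd_image_fundDomain hη hη0, h.isCompact_charSet hη hη0,
    ⟨h.charSet_eq_closure_iUnion hη hη0, h.liminf_charSetLevel_eq_limsup hη hη0,
      h.charSet_eq_closure_limsup_charSetLevel hη hη0⟩,
    ⟨h.charSet_eq_closure_liminf_charApprox hη hη0, h.charSet_eq_closure_limsup_charApprox hη hη0⟩,
    h.interior_charSet_subset_liminf hη hη0,
    ⟨h.image_sub_charSet_subset_tile hη hη0, h.image_sub_charApprox_subset_tile hη hη0⟩,
    ⟨h.nullMeasurableSet_image_fracPart_charSet hT'T hT' hη hη0,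
      (h.measure_image_fracPart_charSet hT'T hT' hη hη0).symm, fun j =>
      ⟨h.nullMeasurableSet_image_fracPart_charApprox hT'T hT' hη hη0 j,
        (h.measure_image_fracPart_charApprox hT'T hT' hη hη0 j).symm⟩⟩,
    ⟨WNAF.decayConst_lt_one h.ratio_pos n hw, h.exists_abs_measureReal_charApprox_sub_le hη hη0⟩,
    (h.measure_image_fracPart_charSet hT'T hT' hη hη0).trans (h.measure_charSet hη hη0),
    fun j => ⟨h.integrableOn_indicator_image_fracPart_sub hT'T hT' hη hη0 j,
      h.beta_eq_setIntegral hT'T hT' hη hη0 j⟩,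
    h.exists_abs_beta_le hη hη0⟩
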